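/- Let $\Lambda=\mathbb Z+\mathbb Z e^{\pi i/3}\subset\mathbb C$ be the set of vertices of the tiling of the plane by equilateral triangles of side $1$. Let $\Sigma_{1,1}=(\mathbb C\setminus\Lambda)/\Lambda$ be the once-punctured torus and $\mathrm{UT}(\Sigma_{1,1})=\big((\mathbb C\setminus\Lambda)\times S^1\big)/\Lambda$ its unit tangent bundle, where $\Lambda$ acts by translations on the first factor and trivially on $S^1$, the circle of unit vectors in $\mathbb C$. Let $\Sigma_{\mathrm{Mod}}=\mathbb H^2/\mathrm{PSL}(2,\mathbb Z)$ be the modular surface (an orbifold) and $\mathrm{UT}(\Sigma_{\mathrm{Mod}})=\mathrm{UT}(\mathbb H^2)/\mathrm{PSL}(2,\mathbb Z)$ its unit tangent bundle, where $\mathrm{PSL}(2,\mathbb Z)$ acts on $\mathbb H^2$ by Möbius transformations and on $\mathrm{UT}(\mathbb H^2)$ by their differentials. Let $c$ be the centre of the triangle with vertices $0,1,e^{\pi i/3}$, and let $m=\tfrac12$ be the centre of its edge from $0$ to $1$. 1. There is an orbifold covering $p:\Sigma_{1,1}\to\Sigma_{\mathrm{Mod}}$ of degree $6$ whose group of covering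 transformations (all homeomorphisms $f$ of $\Sigma_{1,1}$ with $p\circ f=p$) is generated by two elements $V$ and $U$: the map $V$ induced by the rotation of the plane by $2\pi/3$ about $c$, which has order $3$, and the map $U$ induced by the rotation by $\pi$ about $m$, which has order $2$. (Degree $6$ means that for every $x\in\mathbb H^2$ the number of points of $\Sigma_{1,1}$ above the image of $x$, times the order of the stabilizer of $x$ in $\mathrm{PSL}(2,\mathbb Z)$, is $6$.) 2. There is a $6$-fold covering map $P:\mathrm{UT}(\Sigma_{1,1})\to\mathrm{UT}(\Sigma_{\mathrm{Mod}})$ whose group of covering transformations is generated by two elements $\widehat V$ and $\widehat U$: the map $\widehat V$ of order $3$ induced by the glide rotation $(z,v)\mapsto\big(c+e^{2\pi i/3}(z-c),\,e^{2\pi i/3}v\big)$, and the map $\widehat U$ of order $2$ induced by the glide rotation $(z,v)\mapsto\big(2m-z,\,-v\big)$. Moreover, $p$ and $P$ can be chosen so that $P$ lies over $p$, i.e. they commute with the projections of the two unit tangent bundles to $\Sigma_{1,1}$ and $\Sigma_{\mathrm{Mod}}$. -/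

import Mathlib

open scoped UpperHalfPlane MatrixGroups

namespace SixFold

noncomputable section

/-! ### Coverings -/

/-- The group of covering transformations of a map `p : M → B`: all self-homeomorphisms `f` of `M`
with `p ∘ f = p`. -/
def deckGroup {M B : Type*} [TopologicalSpace M] (p : M → B) : Subgroup (M ≃ₜ M) where
  carrier := {f | ∀ x, p (f x) = p x}
  one_mem' := fun _ => rfl
  mul_mem' := fun {f g} hf hg x => (hf (g x)).trans (hg x)
  inv_mem' := fun {f} hf x => by
    have h := hf (f.symm x)
    rw [Homeomorph.apply_symm_apply] at h
    exact h.symm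

/-- A covering map all of whose fibres have exactly `n` points. -/
def IsCoverOfDegree {M B : Type*} [TopologicalSpace M] [TopologicalSpace B]
    (n : ℕ) (P : M → B) : Prop :=
  IsCoveringMap P ∧ ∀ b, Nat.card (P ⁻¹' {b}) = n

/-- `p : M → X / G` is an orbifold covering, from a manifold `M` (with trivial local groups) to the
orbifold `X / G`, for a faithful, properly discontinuous action of `G` on a manifold `X`.

Near the image of `x`, the orbifold `X / G` has the chart `U → U / G_x`, where `G_x` is the
stabilizer of `x` and `U` is a neighbourhood of `x` that is preserved by `G_x` and disjoint from its
translates by all other elements of `G`.  The covering condition is that the part of `M` above the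
image of `U` is a disjoint union of copies of `U` (namely quotients of `U` by subgroups of `G_x`
that act freely on `U`; such a subgroup is trivial, because `G_x` fixes `x`), on each of which `p`
is the quotient map. -/
def IsOrbifoldCover.{u, v, w} {G : Type u} {X : Type v} {M : Type w} [Group G] [MulAction G X]
    [TopologicalSpace X] [TopologicalSpace M]
    (p : M → Quotient (MulAction.orbitRel G X)) : Prop :=
  Continuous p ∧
  ∀ x : X, ∃ U : Set X, IsOpen U ∧ x ∈ U ∧
    (∀ g ∈ MulAction.stabilizer G x, ∀ y ∈ U, g • y ∈ U) ∧
    (∀ g ∉ MulAction.stabilizer G x, ∀ y ∈ U, g • y ∉ U) ∧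
    ∃ (ι : Type w) (_ : TopologicalSpace ι) (_ : DiscreteTopology ι)
      (Φ : U × ι ≃ₜ
        (p ⁻¹' ((Quotient.mk (MulAction.orbitRel G X)) '' U) : Set M)),
      ∀ a : U × ι, p (Φ a : M) = Quotient.mk (MulAction.orbitRel G X) (a.1 : X)

/-- An orbifold covering of degree `n` by a manifold: the number of points above the image of any
`x`, each counted with weight the order of the local group `G_x`, is `n`.  (In particular, above a
point with trivial local group there are exactly `n` points.) -/
def IsOrbifoldCoverOfDegree {G X M : Type*} [Group G] [MulAction G X]
    [TopologicalSpace X] [TopologicalSpace M]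
    (n : ℕ) (p : M → Quotient (MulAction.orbitRel G X)) : Prop :=
  IsOrbifoldCover p ∧
  ∀ x : X, Nat.card (p ⁻¹' {Quotient.mk (MulAction.orbitRel G X) x}) *
    Nat.card (MulAction.stabilizer G x) = n

/-! ### The modular surface and its unit tangent bundle -/

/-- The unit tangent bundle of the hyperbolic plane: pairs of a point `z` of the upper half plane
and a tangent vector `v` at `z` of hyperbolic length `|v| / Im z` equal to `1`. -/
def UTH : Type := {q : ℍ × ℂ // ‖q.2‖ = q.1.im}

instance : TopologicalSpace UTH := instTopologicalSpaceSubtype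

/-- A matrix of determinant one acts on unit tangent vectors by the differential of the Möbius
transformation `z ↦ (a z + b) / (c z + d)`, whose derivative is `1 / (c z + d) ^ 2`. -/
instance : MulAction SL(2, ℤ) UTH where
  smul g q := ⟨(g • q.1.1, q.1.2 / (UpperHalfPlane.denom g q.1.1) ^ 2), by
    have h := q.2
    simp only [norm_div, norm_pow, h]
    rw [ModularGroup.im_smul_eq_div_normSq, Complex.normSq_eq_norm_sq]⟩
  one_smul q := by
    apply Subtype.ext
    change ((1 : SL(2, ℤ)) • q.1.1, q.1.2 / (UpperHalfPlane.denom _ q.1.1) ^ 2) = q.1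
    ext1
    · simp
    · simp
  mul_smul g h q := by
    apply Subtype.ext
    change ((g * h) • q.1.1, q.1.2 / (UpperHalfPlane.denom _ q.1.1) ^ 2) =
      (g • h • q.1.1, q.1.2 / (UpperHalfPlane.denom _ q.1.1) ^ 2 /
        (UpperHalfPlane.denom _ (h • q.1.1 : ℍ)) ^ 2)
    ext1
    · exact mul_smul g h q.1.1
    · have hc : UpperHalfPlane.denom ((g * h : SL(2, ℤ)) : GL (Fin 2) ℝ) (q.1.1 : ℂ) =
          UpperHalfPlane.denom g (h • q.1.1 : ℍ) * UpperHalfPlane.denom h q.1.1 := by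
        rw [map_mul, map_mul, UpperHalfPlane.denom_cocycle _ _ q.1.1.im_ne_zero,
          ModularGroup.sl_moeb, UpperHalfPlane.coe_smul_of_det_pos (by simp)]
      simp only [hc]
      rw [mul_pow, div_div, mul_comm]

/-- A central element of `SL(2, ℤ)` is `1` or `-1`. -/
lemma eq_one_or_neg_one_of_mem_center {g : SL(2, ℤ)} (hg : g ∈ Subgroup.center SL(2, ℤ)) :
    g = 1 ∨ g = -1 := by
  obtain ⟨r, hr, h⟩ := Matrix.SpecialLinearGroup.mem_center_iff.mp hg
  have hr2 : r = 1 ∨ r = -1 := by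
    simpa [sq_eq_one_iff] using hr
  rcases hr2 with rfl | rfl
  · left
    apply Subtype.ext
    rw [← h]
    simp
  · right
    apply Subtype.ext
    rw [← h]
    simp

/-- An action of `SL(2, ℤ)` in which `-1` acts trivially, as an action of `PSL(2, ℤ)`. -/
def pslHom (X : Type*) [MulAction SL(2, ℤ) X] (h : ∀ x : X, (-1 : SL(2, ℤ)) • x = x) :
    PSL(2, ℤ) →* Equiv.Perm X :=
  QuotientGroup.lift _ (MulAction.toPermHom SL(2, ℤ) X) (by
    intro g hg
    rcases eq_one_or_neg_one_of_mem_center hg with rfl | rfl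
    · exact map_one _
    · exact Equiv.ext h)

/-- The modular group `PSL(2, ℤ)` acting on the upper half plane by Möbius transformations. -/
instance : MulAction PSL(2, ℤ) ℍ :=
  MulAction.compHom ℍ (pslHom ℍ (fun z => by
    rw [ModularGroup.SL_neg_smul, one_smul]))

/-- The modular group `PSL(2, ℤ)` acting on unit tangent vectors by differentials. -/
instance : MulAction PSL(2, ℤ) UTH :=
  MulAction.compHom UTH (pslHom UTH (fun q => by
    apply Subtype.ext
    change ((-1 : SL(2, ℤ)) • q.1.1, q.1.2 / (UpperHalfPlane.denom _ q.1.1) ^ 2) = q.1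
    ext1
    · rw [ModularGroup.SL_neg_smul, one_smul]
    · change q.1.2 / (UpperHalfPlane.denom ((-1 : SL(2, ℤ)) : GL (Fin 2) ℝ) q.1.1) ^ 2 = q.1.2
      rw [ModularGroup.denom_apply]
      simp))

lemma psl_smul_pt (g : SL(2, ℤ)) (z : ℍ) : (g : PSL(2, ℤ)) • z = g • z := rfl

lemma psl_smul_base (g : PSL(2, ℤ)) (q : UTH) : (g • q).1.1 = g • q.1.1 := by
  induction g using QuotientGroup.induction_on with
  | H g => rfl

/-- The modular surface, the orbifold quotient of the hyperbolic plane by `PSL(2, ℤ)`. -/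
abbrev ModularSurface : Type := Quotient (MulAction.orbitRel PSL(2, ℤ) ℍ)

/-- The unit tangent bundle of the modular surface, the quotient of the unit tangent bundle of the
hyperbolic plane by the differentials of the elements of `PSL(2, ℤ)`. -/
abbrev UTModularSurface : Type := Quotient (MulAction.orbitRel PSL(2, ℤ) UTH)

/-- The projection from the unit tangent bundle of the modular surface to the modular surface. -/
def projMod : UTModularSurface → ModularSurface :=
  Quotient.map (fun q : UTH => q.1.1) (by
    rintro a b ⟨g, hg⟩
    exact ⟨g, by rw [← hg]; exact (psl_smul_base g b).symm⟩)

/-! ### The once-punctured torus and its unit tangent bundle -/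

/-- The vertices of the tiling of the plane by equilateral triangles of side one: the lattice
spanned by `1` and `exp (π i / 3)`. -/
def lattice : AddSubgroup ℂ :=
  AddSubgroup.closure {1, Complex.exp ((Real.pi / 3 : ℝ) * Complex.I)}

/-- The plane with the vertices of the tiling removed. -/
def PuncturedPlane : Type := {z : ℂ // z ∉ lattice}

instance : TopologicalSpace PuncturedPlane := instTopologicalSpaceSubtype

/-- The lattice acts by translations. -/
instance : AddAction lattice PuncturedPlane where
  vadd l z := ⟨(l : ℂ) + z.1, fun h => z.2 ((lattice.add_mem_cancel_left l.2).mp h)⟩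
  zero_vadd z := Subtype.ext (zero_add z.1)
  add_vadd l m z := Subtype.ext (add_assoc (l : ℂ) m z.1)

/-- The unit tangent bundle of the punctured plane: pairs of a point and a unit vector. -/
abbrev UTPuncturedPlane : Type := PuncturedPlane × Circle

/-- The differential of a translation moves the base point and keeps the vector. -/
instance : AddAction lattice UTPuncturedPlane where
  vadd l q := (l +ᵥ q.1, q.2)
  zero_vadd q := Prod.ext (zero_vadd lattice q.1) rfl
  add_vadd l m q := Prod.ext (add_vadd l m q.1) rfl

/-- The once-punctured torus: the punctured plane modulo the translations by the lattice. -/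
abbrev PuncturedTorus : Type := Quotient (AddAction.orbitRel lattice PuncturedPlane)

/-- The unit tangent bundle of the once-punctured torus. -/
abbrev UTPuncturedTorus : Type := Quotient (AddAction.orbitRel lattice UTPuncturedPlane)

/-- The class of a point of the punctured plane in the punctured torus. -/
def toTorus (z : PuncturedPlane) : PuncturedTorus := Quotient.mk _ z

/-- The class of a unit tangent vector of the punctured plane. -/
def toUTTorus (z : PuncturedPlane) (v : Circle) : UTPuncturedTorus := Quotient.mk _ (z, v)

/-- The projection from the unit tangent bundle of the punctured torus to the punctured torus. -/
def projTorus : UTPuncturedTorus → PuncturedTorus :=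
  Quotient.map (fun q : UTPuncturedPlane => q.1) (by
    rintro a b ⟨l, hl⟩
    exact ⟨l, by rw [← hl]; rfl⟩)

/-! ### Rotations and glide rotations -/

/-- The rotation of the plane by the angle `θ` about the point `c`. -/
def rotate (c : ℂ) (θ : ℝ) (z : ℂ) : ℂ := c + Circle.exp θ * (z - c)

/-- `f` is the self-map of the punctured torus induced by the rotation of the plane by the angle `θ`
about `c`. -/
def IsRotation (f : PuncturedTorus ≃ₜ PuncturedTorus) (c : ℂ) (θ : ℝ) : Prop :=
  ∀ z : PuncturedPlane, ∃ w : PuncturedPlane,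
    w.1 = rotate c θ z.1 ∧ f (toTorus z) = toTorus w

/-- `F` is the self-map of the unit tangent bundle of the punctured torus induced by the glide
rotation that rotates the plane by `θ` about `c` and translates the direction by `θ`. -/
def IsGlideRotation (F : UTPuncturedTorus ≃ₜ UTPuncturedTorus) (c : ℂ) (θ : ℝ) : Prop :=
  ∀ (z : PuncturedPlane) (v : Circle), ∃ w : PuncturedPlane,
    w.1 = rotate c θ z.1 ∧ F (toUTTorus z v) = toUTTorus w (Circle.exp θ * v)

/-- The centre of the triangle of the tiling with vertices `0`, `1` and `exp (π i / 3)`. -/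
def triangleCentre : ℂ := (0 + 1 + Complex.exp ((Real.pi / 3 : ℝ) * Complex.I)) / 3

/-- The centre of the edge of that triangle from `0` to `1`. -/
def edgeCentre : ℂ := (0 + 1) / 2

end

end SixFold

namespace SixFold

open Complex ComplexConjugate

/-! ### The sixth roots of unity and the triangular lattice -/

/-! The fourth power of the eta function has weight two and a character of order six, so the
differential `η ^ 4 dτ` on the upper half plane is multiplied by a sixth root of unity under every
modular transformation. Hence a suitably scaled primitive `dev` turns modular transformations into
motions `z ↦ a z + l` with `a` in `sixth` and `l` in the lattice: `T` becomes the rotation by `π /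
3` about `0`, `S` the half-turn about `1 / 2` (`exists_develops`). These two generate all such
motions (`exists_develops_motion`).

The core is that `dev` maps the upper half plane onto the complement of the lattice
(`exists_dev_eq`) and that points whose values differ by a motion differ by a modular transformation
developing into that motion (`exists_develops_of_dev_eq`). Dividing by the lattice identifies the
modular surface with the quotient of the punctured torus by `sixth`. The covering property, the
degree and the deck group are then read off from the action of `sixth` (`IsEquivariantCover`).

In the coordinate `t = exp (π i τ / 3)` the primitive extends over the cusp `t = 0`, and on a disc
covering the fundamental domain its increments differ from those of the identity by at most a factor
`1 / 2`. With the reflection symmetries this shows that `dev` maps the fundamental domain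
injectively into `kite`, one sixth of the Voronoi cell of the vertex `0`; only boundary points can
then be equivalent, and these are matched by `T` and `S`. Surjectivity holds because the image is
open and relatively closed in a connected set.

For the unit tangent bundles, the direction of the image of a tangent vector under the derivative of
`dev` trivialises the bundle (`utHomeo`). A modular transformation with rotational part `a`
multiplies this direction by `a`, so the same scheme applies, now with a free action of `sixth`. -/

/-- The primitive sixth root of unity `exp (π i / 3)`. -/
noncomputable def zeta : Circle := Circle.exp (Real.pi / 3)

lemma coe_zeta : (zeta : ℂ) = exp ((Real.pi / 3 : ℝ) * I) := Circle.coe_exp _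

lemma zeta_re : (zeta : ℂ).re = 1 / 2 := by
  rw [coe_zeta, exp_ofReal_mul_I_re, Real.cos_pi_div_three]

lemma zeta_im : (zeta : ℂ).im = √3 / 2 := by
  rw [coe_zeta, exp_ofReal_mul_I_im, Real.sin_pi_div_three]

lemma sqrt_three_mul_self : √3 * √3 = 3 := Real.mul_self_sqrt (by norm_num)

lemma zeta_sq : (zeta : ℂ) ^ 2 = zeta - 1 := by
  have h := sqrt_three_mul_self
  apply Complex.ext
  · simp only [sq, mul_re, sub_re, zeta_re, zeta_im, one_re]; linarith
  · simp only [sq, mul_im, sub_im, zeta_re, zeta_im, one_im]; ring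

lemma zeta_cube : (zeta : ℂ) ^ 3 = -1 := by
  linear_combination ((zeta : ℂ) + 1) * zeta_sq

lemma zeta_pow_six : zeta ^ 6 = 1 := by
  apply Circle.coe_injective
  push_cast
  linear_combination ((zeta : ℂ) ^ 3 - 1) * zeta_cube

lemma zeta_inv : ((zeta⁻¹ : Circle) : ℂ) = 1 - zeta := by
  rw [Circle.coe_inv, inv_eq_iff_eq_inv, eq_comm]
  apply inv_eq_of_mul_eq_one_left
  linear_combination -zeta_sq

lemma conj_zeta : conj (zeta : ℂ) = 1 - zeta := by
  rw [← Circle.coe_inv_eq_conj, zeta_inv]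

lemma orderOf_zeta : orderOf zeta = 6 := by
  have h2 : zeta ^ 2 ≠ 1 := by
    intro h
    have h' := congrArg (fun z : Circle => (z : ℂ).re) h
    simp only [Circle.coe_pow, zeta_sq, sub_re, zeta_re, Circle.coe_one, one_re] at h'
    norm_num at h'
  have h3 : zeta ^ 3 ≠ 1 := by
    intro h
    have h' := congrArg (fun z : Circle => (z : ℂ).re) h
    simp only [Circle.coe_pow, zeta_cube, neg_re, Circle.coe_one, one_re] at h'
    norm_num at h'
  refine orderOf_eq_of_pow_and_pow_div_prime (by norm_num) zeta_pow_six fun p hp hd => ?_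
  have : p = 2 ∨ p = 3 := by
    have hle : p ≤ 6 := Nat.le_of_dvd (by norm_num) hd
    interval_cases p <;> revert hp hd <;> decide
  rcases this with rfl | rfl
  · exact h3
  · exact h2

/-- The group of sixth roots of unity in the circle. -/
noncomputable abbrev sixth : Subgroup Circle := Subgroup.zpowers zeta

/-- The generator of the group of sixth roots of unity. -/
noncomputable def zetaGen : sixth := ⟨zeta, Subgroup.mem_zpowers zeta⟩

lemma card_sixth : Nat.card sixth = 6 := by
  rw [Nat.card_zpowers, orderOf_zeta]

instance : Finite sixth := Nat.finite_of_card_ne_zero (by rw [card_sixth]; norm_num)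

lemma exists_pow_of_mem_sixth {a : Circle} (ha : a ∈ sixth) : ∃ k < 6, a = zeta ^ k := by
  have hfin : IsOfFinOrder zeta := isOfFinOrder_iff_pow_eq_one.mpr ⟨6, by norm_num, zeta_pow_six⟩
  obtain ⟨k, rfl⟩ := (Submonoid.mem_powers_iff _ _).mp (hfin.mem_powers_iff_mem_zpowers.mpr ha)
  refine ⟨k % 6, Nat.mod_lt _ (by norm_num), ?_⟩
  rw [← orderOf_zeta, pow_mod_orderOf]

lemma zeta_cube_eq_exp_pi : zeta ^ 3 = Circle.exp Real.pi := by
  rw [zeta, ← Circle.exp_nsmul]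
  congr 1
  simp only [nsmul_eq_mul]
  push_cast
  ring

lemma mem_lattice {z : ℂ} : z ∈ lattice ↔ ∃ m n : ℤ, z = m + n * zeta := by
  rw [lattice, AddSubgroup.mem_closure_pair, ← coe_zeta]
  simp only [zsmul_eq_mul, mul_one, eq_comm]

lemma one_mem_lattice : (1 : ℂ) ∈ lattice := mem_lattice.mpr ⟨1, 0, by simp⟩

lemma zeta_mul_mem_lattice {z : ℂ} (hz : z ∈ lattice) : (zeta : ℂ) * z ∈ lattice := by
  obtain ⟨m, n, rfl⟩ := mem_lattice.mp hz
  refine mem_lattice.mpr ⟨-n, m + n, ?_⟩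
  push_cast
  linear_combination (n : ℂ) * zeta_sq

lemma sixth_mul_mem_lattice {a : Circle} (ha : a ∈ sixth) {z : ℂ} (hz : z ∈ lattice) :
    (a : ℂ) * z ∈ lattice := by
  obtain ⟨k, -, rfl⟩ := exists_pow_of_mem_sixth ha
  induction k with
  | zero => simpa using hz
  | succ k ih =>
    rw [pow_succ', Circle.coe_mul, mul_assoc]
    exact zeta_mul_mem_lattice (ih (pow_mem (Subgroup.mem_zpowers zeta) k))

lemma sixth_mul_mem_lattice_iff {a : Circle} (ha : a ∈ sixth) {z : ℂ} :
    (a : ℂ) * z ∈ lattice ↔ z ∈ lattice := by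
  refine ⟨fun h => ?_, sixth_mul_mem_lattice ha⟩
  have := sixth_mul_mem_lattice (inv_mem ha) h
  rwa [← mul_assoc, ← Circle.coe_mul, inv_mul_cancel, Circle.coe_one, one_mul] at this

/-! ### The norm form of the lattice and its short vectors. -/

lemma normSq_add_mul_zeta (m n : ℝ) : normSq (m + n * zeta) = m ^ 2 + m * n + n ^ 2 := by
  have h := sqrt_three_mul_self
  rw [normSq_apply]
  simp only [add_re, add_im, mul_re, mul_im, ofReal_re, ofReal_im, zeta_re, zeta_im]
  linear_combination (n ^ 2 / 4) * h

/-- The square of the length of a lattice vector is an integer. -/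
lemma exists_normSq_eq_of_mem_lattice {z : ℂ} (hz : z ∈ lattice) :
    ∃ m n : ℤ, z = m + n * zeta ∧ normSq z = ((m ^ 2 + m * n + n ^ 2 : ℤ) : ℝ) := by
  obtain ⟨m, n, rfl⟩ := mem_lattice.mp hz
  refine ⟨m, n, rfl, ?_⟩
  have := normSq_add_mul_zeta m n
  push_cast at this ⊢
  exact this

lemma one_le_normSq_of_mem_lattice {z : ℂ} (hz : z ∈ lattice) (h0 : z ≠ 0) : 1 ≤ normSq z := by
  obtain ⟨m, n, -, h⟩ := exists_normSq_eq_of_mem_lattice hz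
  have hp : 0 < normSq z := normSq_pos.mpr h0
  rw [h] at hp ⊢
  exact_mod_cast hp

/-- The form `m ^ 2 + m n + n ^ 2` omits the value `2`. Four times it is `3 m ^ 2 + (m + 2 n) ^ 2`,
which bounds `m`, and likewise `n`. -/
lemma normSq_eq_one_of_lt_three {z : ℂ} (hz : z ∈ lattice) (h0 : z ≠ 0) (h3 : normSq z < 3) :
    normSq z = 1 := by
  obtain ⟨m, n, rfl, h⟩ := exists_normSq_eq_of_mem_lattice hz
  have h1 := one_le_normSq_of_mem_lattice hz h0
  rw [h] at h1 h3 ⊢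
  have h1' : 1 ≤ m ^ 2 + m * n + n ^ 2 := by exact_mod_cast h1
  have h3' : m ^ 2 + m * n + n ^ 2 < 3 := by exact_mod_cast h3
  have hm : m ^ 2 < 4 := by nlinarith [sq_nonneg (m + 2 * n)]
  have hn : n ^ 2 < 4 := by nlinarith [sq_nonneg (n + 2 * m)]
  have hm1 : -2 < m ∧ m < 2 := abs_lt.mp (abs_lt_of_sq_lt_sq (by linarith) (by norm_num))
  have hn1 : -2 < n ∧ n < 2 := abs_lt.mp (abs_lt_of_sq_lt_sq (by linarith) (by norm_num))
  obtain ⟨hm1, hm2⟩ := hm1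
  obtain ⟨hn1, hn2⟩ := hn1
  norm_cast
  interval_cases m <;> interval_cases n <;> omega

/-- The lattice vectors of length one with nonnegative real part lie in directions `0`, `±π/3`. -/
lemma eq_of_normSq_eq_one {z : ℂ} (hz : z ∈ lattice) (h1 : normSq z = 1) (hre : 0 < z.re) :
    z = 1 ∨ z = zeta ∨ z = 1 - zeta := by
  obtain ⟨m, n, rfl, h⟩ := exists_normSq_eq_of_mem_lattice hz
  rw [h] at h1
  have h1' : m ^ 2 + m * n + n ^ 2 = 1 := by exact_mod_cast h1
  simp only [add_re, mul_re, intCast_re, intCast_im, zeta_re] at hre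
  have hre' : 0 < 2 * m + n := by
    have : (0 : ℝ) < 2 * m + n := by linarith
    exact_mod_cast this
  have hm : m ^ 2 < 4 := by nlinarith [sq_nonneg (m + 2 * n)]
  have hn : n ^ 2 < 4 := by nlinarith [sq_nonneg (n + 2 * m)]
  obtain ⟨hm1, hm2⟩ : -2 < m ∧ m < 2 := abs_lt.mp (abs_lt_of_sq_lt_sq (by linarith) (by norm_num))
  obtain ⟨hn1, hn2⟩ : -2 < n ∧ n < 2 := abs_lt.mp (abs_lt_of_sq_lt_sq (by linarith) (by norm_num))
  interval_cases m <;> interval_cases n <;> first | omega | skip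
  · right; left; simp
  · right; right; simp [sub_eq_add_neg]
  · left; simp

instance : Countable lattice := by
  have : (lattice : Set ℂ) = Set.range fun p : ℤ × ℤ => (p.1 + p.2 * zeta : ℂ) := by
    ext z
    simp only [SetLike.mem_coe, mem_lattice, Set.mem_range, Prod.exists, eq_comm]
  exact (this ▸ Set.countable_range _ : (lattice : Set ℂ).Countable).to_subtype

instance : DiscreteTopology lattice := by
  refine DiscreteTopology.of_forall_le_dist zero_lt_one fun x y hxy => ?_
  change 1 ≤ dist (x : ℂ) y
  rw [dist_eq]
  have h := one_le_normSq_of_mem_lattice (sub_mem x.2 y.2)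
    (sub_ne_zero.mpr fun h => hxy (Subtype.ext h))
  rw [normSq_eq_norm_sq] at h
  exact (one_le_sq_iff₀ (norm_nonneg _)).mp h

lemma isClosed_lattice : IsClosed (lattice : Set ℂ) := AddSubgroup.isClosed_of_discrete

/-! ### A primitive of the fourth power of the eta function -/

/-- The product `∏ (1 - t ^ (6 (n + 1))) ^ 4`, so that `η ^ 4 = t * etaProd t` for
`t = exp (π i τ / 3)`. -/
noncomputable def etaProd (t : ℂ) : ℂ := (∏' n : ℕ, (1 - (t ^ 6) ^ (n + 1))) ^ 4

lemma pow_six_mem_ball {t : ℂ} (ht : t ∈ Metric.ball (0 : ℂ) 1) :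
    t ^ 6 ∈ Metric.ball (0 : ℂ) 1 := by
  rw [mem_ball_zero_iff] at ht ⊢
  rw [norm_pow]
  exact pow_lt_one₀ (norm_nonneg _) ht (by norm_num)

lemma differentiableOn_etaProd : DifferentiableOn ℂ etaProd (Metric.ball 0 1) :=
  (ModularForm.differentiableOn_tprod_one_sub_pow.comp (by fun_prop)
    fun _ ht => pow_six_mem_ball ht).pow 4

/-- The radius `9 / 20` is large enough for the cusp coordinates of the whole fundamental domain,
yet makes `t ^ 6` at most `1 / 100`. The bound `1 / 2` is far from sharp but suffices for the later
geometry. -/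
lemma norm_etaProd_sub_one_le {t : ℂ} (ht : ‖t‖ ≤ 9 / 20) : ‖etaProd t - 1‖ ≤ 1 / 2 := by
  have hq : ‖t ^ 6‖ ≤ 1 / 100 := by
    rw [norm_pow]
    exact (pow_le_pow_left₀ (norm_nonneg _) ht 6).trans (by norm_num)
  set q := t ^ 6
  have hq1 : ‖q‖ < 1 := hq.trans_lt (by norm_num)
  -- The number `1 / 99` is the geometric sum `r / (1 - r)` at `r = 1 / 100`.
  have hexp : Real.exp (1 / 99) - 1 ≤ 1 / 50 := by
    have := Real.exp_bound_div_one_sub_of_interval (x := 1 / 99) (by norm_num) (by norm_num)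
    norm_num at this ⊢
    linarith
  have hp : ‖∏' n : ℕ, (1 - q ^ (n + 1)) - 1‖ ≤ 1 / 50 := by
    have hm := (ModularForm.multipliable_one_sub_pow hq1).hasProd
    refine le_of_tendsto (Filter.Tendsto.norm (hm.sub_const 1)) (Filter.Eventually.of_forall ?_)
    intro s
    have h := s.norm_prod_one_add_sub_one_le fun n : ℕ => -q ^ (n + 1)
    simp only [← sub_eq_add_neg] at h
    refine h.trans (le_trans ?_ hexp)
    gcongr
    have hs : Summable fun n : ℕ => ‖q‖ ^ (n + 1) :=
      (summable_nat_add_iff 1).mpr (summable_geometric_of_lt_one (norm_nonneg _) hq1)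
    calc ∑ n ∈ s, ‖-q ^ (n + 1)‖ = ∑ n ∈ s, ‖q‖ ^ (n + 1) := by simp
      _ ≤ ∑' n : ℕ, ‖q‖ ^ (n + 1) := hs.sum_le_tsum s fun _ _ => by positivity
      _ = ‖q‖ * (1 - ‖q‖)⁻¹ := by
        simp only [pow_succ']
        rw [tsum_mul_left, tsum_geometric_of_lt_one (norm_nonneg _) hq1]
      _ ≤ 1 / 99 := by
        rw [← div_eq_mul_inv, div_le_iff₀ (by linarith)]
        linarith
  rw [etaProd]
  set P := ∏' n : ℕ, (1 - q ^ (n + 1))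
  have hP : ‖P‖ ≤ 51 / 50 := by
    have := norm_le_norm_sub_add P 1
    rw [norm_one] at this
    linarith
  calc ‖P ^ 4 - 1‖ = ‖(P - 1) * (P ^ 3 + P ^ 2 + P + 1)‖ := by congr 1; ring
    _ ≤ ‖P - 1‖ * (‖P‖ ^ 3 + ‖P‖ ^ 2 + ‖P‖ + 1) := by
      rw [norm_mul]
      gcongr
      refine (norm_add_le _ _).trans (add_le_add ((norm_add_le _ _).trans (add_le_add
        ((norm_add_le _ _).trans (add_le_add ?_ ?_)) le_rfl)) ?_) <;> simp
    _ ≤ 1 / 50 * ((51 / 50) ^ 3 + (51 / 50) ^ 2 + 51 / 50 + 1) := by gcongr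
    _ ≤ 1 / 2 := by norm_num

lemma etaProd_mul_of_pow_six {a : ℂ} (ha : a ^ 6 = 1) (t : ℂ) : etaProd (a * t) = etaProd t := by
  rw [etaProd, mul_pow, ha, one_mul, etaProd]

lemma etaProd_conj (t : ℂ) : etaProd (conj t) = conj (etaProd t) := by
  simp only [etaProd, map_pow]
  congr 1
  rw [Function.LeftInverse.map_tprod _ (g := starRingEnd ℂ) continuous_conj continuous_conj
    (fun z => conj_conj z)]
  simp

lemma exists_primitive_etaProd :
    ∃ F : ℂ → ℂ, F 0 = 0 ∧ ∀ t ∈ Metric.ball (0 : ℂ) 1, HasDerivAt F (etaProd t) t :=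
  differentiableOn_etaProd.isExactOn_ball.with_val_at 0 0

/-- The primitive of `etaProd` on the unit disc that vanishes at the origin. -/
noncomputable def prim : ℂ → ℂ := exists_primitive_etaProd.choose

lemma prim_zero : prim 0 = 0 := exists_primitive_etaProd.choose_spec.1

lemma hasDerivAt_prim {t : ℂ} (ht : ‖t‖ < 1) : HasDerivAt prim (etaProd t) t :=
  exists_primitive_etaProd.choose_spec.2 t (mem_ball_zero_iff.mpr ht)

lemma eqOn_of_hasDerivAt {f g f' : ℂ → ℂ} {s : Set ℂ} (hs : IsOpen s) (hc : IsPreconnected s)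
    (hf : ∀ x ∈ s, HasDerivAt f (f' x) x) (hg : ∀ x ∈ s, HasDerivAt g (f' x) x)
    {x : ℂ} (hx : x ∈ s) (hfg : f x = g x) : s.EqOn f g :=
  hs.eqOn_of_deriv_eq hc (fun y hy => (hf y hy).differentiableAt.differentiableWithinAt)
    (fun y hy => (hg y hy).differentiableAt.differentiableWithinAt)
    (fun y hy => (hf y hy).deriv.trans (hg y hy).deriv.symm) hx hfg

/-- Both sides vanish at the origin and have the same derivative, because `etaProd` depends only on
`t ^ 6`. -/
lemma prim_mul_of_pow_six {a : ℂ} (ha : a ^ 6 = 1) {t : ℂ} (ht : ‖t‖ < 1) :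
    prim (a * t) = a * prim t := by
  have hn : ‖a‖ = 1 := Complex.norm_eq_one_of_pow_eq_one ha (by norm_num)
  refine eqOn_of_hasDerivAt (f := fun t => prim (a * t)) (g := fun t => a * prim t)
    (f' := fun t => a * etaProd t) Metric.isOpen_ball (convex_ball (0 : ℂ) 1).isPreconnected
    (fun x hx => ?_) (fun x hx => ?_) (Metric.mem_ball_self one_pos) ?_ (mem_ball_zero_iff.mpr ht)
  · have hx' : ‖a * x‖ < 1 := by rw [norm_mul, hn, one_mul]; exact mem_ball_zero_iff.mp hx
    have h := (hasDerivAt_prim hx').comp x ((hasDerivAt_id x).const_mul a)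
    rw [etaProd_mul_of_pow_six ha, mul_one, mul_comm] at h
    exact h
  · exact (hasDerivAt_prim (mem_ball_zero_iff.mp hx)).const_mul a
  · simp [prim_zero]

lemma prim_conj {t : ℂ} (ht : ‖t‖ < 1) : prim (conj t) = conj (prim t) := by
  have h : (Metric.ball (0 : ℂ) 1).EqOn (conj ∘ prim ∘ conj) prim := by
    refine eqOn_of_hasDerivAt (f' := etaProd) Metric.isOpen_ball
      (convex_ball (0 : ℂ) 1).isPreconnected (fun x hx => ?_)
      (fun x hx => hasDerivAt_prim (mem_ball_zero_iff.mp hx)) (Metric.mem_ball_self one_pos) ?_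
    · have hx' : ‖conj x‖ < 1 := by rw [norm_conj]; exact mem_ball_zero_iff.mp hx
      have h := (hasDerivAt_prim hx').conj_conj
      rwa [etaProd_conj, conj_conj, conj_conj] at h
    · simp [prim_zero]
  have := h (mem_ball_zero_iff.mpr ht)
  rw [← this]
  simp

/-- `prim` is close to the identity on a disc. -/
lemma norm_prim_sub_sub_le {s t : ℂ} (hs : ‖s‖ ≤ 9 / 20) (ht : ‖t‖ ≤ 9 / 20) :
    ‖prim t - prim s - (t - s)‖ ≤ 1 / 2 * ‖t - s‖ := by
  have h := (convex_closedBall (0 : ℂ) (9 / 20)).norm_image_sub_le_of_norm_hasDerivWithin_le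
    (f := fun t => prim t - t) (f' := fun t => etaProd t - 1) (C := 1 / 2) (x := s) (y := t)
    (fun x hx => ?_) (fun x hx => norm_etaProd_sub_one_le (mem_closedBall_zero_iff.mp hx))
    (mem_closedBall_zero_iff.mpr hs) (mem_closedBall_zero_iff.mpr ht)
  · rw [sub_sub_sub_comm]
    exact h
  · exact ((hasDerivAt_prim ((mem_closedBall_zero_iff.mp hx).trans_lt (by norm_num))).sub
      (hasDerivAt_id x)).hasDerivWithinAt

/-! ### The cusp coordinate and the developing map. -/

/-- The coordinate `exp (π i τ / 3)` near the cusp. -/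
noncomputable def cuspCoord (τ : ℂ) : ℂ := exp ((Real.pi / 3 : ℝ) * I * τ)

lemma norm_cuspCoord (τ : ℂ) : ‖cuspCoord τ‖ = Real.exp (-(Real.pi / 3 * τ.im)) := by
  rw [cuspCoord, norm_exp]
  simp

lemma norm_cuspCoord_lt_one {τ : ℂ} (hτ : 0 < τ.im) : ‖cuspCoord τ‖ < 1 := by
  rw [norm_cuspCoord, Real.exp_lt_one_iff]
  have := Real.pi_pos
  have : 0 < Real.pi / 3 * τ.im := by positivity
  linarith

lemma cuspCoord_ne_zero (τ : ℂ) : cuspCoord τ ≠ 0 := exp_ne_zero _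

lemma hasDerivAt_cuspCoord (τ : ℂ) :
    HasDerivAt cuspCoord ((Real.pi / 3 : ℝ) * I * cuspCoord τ) τ := by
  have h := ((hasDerivAt_id τ).const_mul ((Real.pi / 3 : ℝ) * I : ℂ)).cexp
  rw [mul_one, mul_comm (cexp _)] at h
  exact h

lemma eta_pow_four {τ : ℂ} : ModularForm.eta τ ^ 4 = cuspCoord τ * etaProd (cuspCoord τ) := by
  have h1 : Function.Periodic.qParam 24 τ ^ 4 = cuspCoord τ := by
    rw [Function.Periodic.qParam, cuspCoord, ← Complex.exp_nat_mul]
    congr 1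
    push_cast
    ring
  have h2 : Function.Periodic.qParam 1 τ = cuspCoord τ ^ 6 := by
    rw [Function.Periodic.qParam, cuspCoord, ← Complex.exp_nat_mul]
    congr 1
    push_cast
    ring
  rw [ModularForm.eta, mul_pow, h1, etaProd]
  simp only [ModularForm.eta_q, h2]

lemma cuspCoord_add_one (τ : ℂ) : cuspCoord (τ + 1) = zeta * cuspCoord τ := by
  rw [cuspCoord, cuspCoord, coe_zeta, ← exp_add]
  congr 1
  ring

lemma cuspCoord_neg_conj (τ : ℂ) : cuspCoord (-conj τ) = conj (cuspCoord τ) := by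
  rw [cuspCoord, cuspCoord, ← exp_conj]
  congr 1
  rw [map_mul, map_mul, conj_ofReal, conj_I]
  ring

lemma zeta_pow_six' : (zeta : ℂ) ^ 6 = 1 := by
  rw [← Circle.coe_pow, zeta_pow_six, Circle.coe_one]

/-- The normalisation that takes the point `i` to the middle of an edge. -/
noncomputable def scale : ℝ := 1 / (2 * (prim (cuspCoord I)).re)

/-- The height is at least `√3 / 2`, as in the fundamental domain. The true bound is about `0.404`,
which leaves room to replace `√3 / 2` by `0.866`, `π` by `3` and the exponential by its quadratic
Taylor polynomial. -/
lemma norm_cuspCoord_le {τ : ℂ} (hτ : 3 ≤ 4 * τ.im ^ 2) (hτ0 : 0 < τ.im) :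
    ‖cuspCoord τ‖ ≤ 9 / 20 := by
  have hy : (866 / 1000 : ℝ) ≤ τ.im := by nlinarith
  rw [norm_cuspCoord, Real.exp_neg]
  rw [inv_le_comm₀ (Real.exp_pos _) (by norm_num)]
  calc (9 / 20 : ℝ)⁻¹ ≤ 1 + 866 / 1000 + (866 / 1000) ^ 2 / 2 := by norm_num
    _ ≤ Real.exp (866 / 1000) := Real.quadratic_le_exp_of_nonneg (by norm_num)
    _ ≤ Real.exp (Real.pi / 3 * τ.im) := by
      gcongr
      nlinarith [Real.pi_gt_three]

lemma cuspCoord_I_conj : conj (cuspCoord I) = cuspCoord I := by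
  rw [← cuspCoord_neg_conj]; simp

lemma prim_cuspCoord_I : prim (cuspCoord I) = ((prim (cuspCoord I)).re : ℂ) := by
  rw [eq_comm, ← conj_eq_iff_re, ← prim_conj (norm_cuspCoord_lt_one (by simp)), cuspCoord_I_conj]

/-- The cusp coordinate of `i` is a positive real number, and `prim` moves it by at most half its
size. -/
lemma re_prim_cuspCoord_I_pos : 0 < (prim (cuspCoord I)).re := by
  have h1 : ‖cuspCoord I‖ ≤ 9 / 20 := norm_cuspCoord_le (by norm_num) (by simp)
  have h := norm_prim_sub_sub_le (s := 0) (by norm_num) h1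
  rw [prim_zero, sub_zero, sub_zero] at h
  have hr : (cuspCoord I).re = ‖cuspCoord I‖ := by
    rw [norm_cuspCoord, cuspCoord]
    have : ((Real.pi / 3 : ℝ) * I * I : ℂ) = (-(Real.pi / 3) : ℝ) := by
      rw [mul_assoc, I_mul_I]; push_cast; ring
    rw [this, exp_ofReal_re]
    simp
  have h2 := (abs_le.mp ((abs_re_le_norm _).trans h)).1
  rw [sub_re, hr] at h2
  have : 0 < ‖cuspCoord I‖ := norm_pos_iff.mpr (cuspCoord_ne_zero _)
  linarith

lemma scale_pos : 0 < scale := by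
  have := re_prim_cuspCoord_I_pos
  rw [scale]
  positivity

/-- The developing map from the upper half plane to the plane, a primitive of a multiple of
`η ^ 4`. -/
noncomputable def dev (τ : ℂ) : ℂ := scale * prim (cuspCoord τ)

lemma dev_I : dev I = 1 / 2 := by
  have h := re_prim_cuspCoord_I_pos.ne'
  rw [dev, prim_cuspCoord_I, scale, ← ofReal_mul]
  rw [show 1 / (2 * (prim (cuspCoord I)).re) * (prim (cuspCoord I)).re = 1 / 2 by field_simp]
  push_cast
  rfl

/-- The constant factor of `η ^ 4` in the derivative of the developing map. -/
noncomputable def devFactor : ℂ := scale * ((Real.pi / 3 : ℝ) * I)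

lemma devFactor_ne_zero : devFactor ≠ 0 := by
  refine mul_ne_zero (ofReal_ne_zero.mpr scale_pos.ne') (mul_ne_zero ?_ I_ne_zero)
  exact ofReal_ne_zero.mpr (by positivity)

lemma hasDerivAt_dev {τ : ℂ} (hτ : 0 < τ.im) :
    HasDerivAt dev (devFactor * ModularForm.eta τ ^ 4) τ := by
  have h := ((hasDerivAt_prim (norm_cuspCoord_lt_one hτ)).comp τ
    (hasDerivAt_cuspCoord τ)).const_mul (scale : ℂ)
  convert! h using 1
  rw [eta_pow_four, devFactor]
  ring

lemma dev_add_one {τ : ℂ} (hτ : 0 < τ.im) : dev (τ + 1) = zeta * dev τ := by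
  rw [dev, cuspCoord_add_one, prim_mul_of_pow_six zeta_pow_six' (norm_cuspCoord_lt_one hτ), dev]
  ring

lemma dev_neg_conj {τ : ℂ} (hτ : 0 < τ.im) : dev (-conj τ) = conj (dev τ) := by
  rw [dev, cuspCoord_neg_conj, prim_conj (norm_cuspCoord_lt_one hτ), dev, map_mul, conj_ofReal]

lemma eta_pow_four_add_one (τ : ℂ) :
    ModularForm.eta (τ + 1) ^ 4 = zeta * ModularForm.eta τ ^ 4 := by
  rw [eta_pow_four, eta_pow_four, cuspCoord_add_one, etaProd_mul_of_pow_six zeta_pow_six']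
  ring

/-- The fourth power removes the choice of square root in the transformation law of eta; the sign is
`i ^ (-2)`. -/
lemma eta_pow_four_neg_inv {τ : ℂ} (hτ : 0 < τ.im) :
    ModularForm.eta (-1 / τ) ^ 4 = -τ ^ 2 * ModularForm.eta τ ^ 4 := by
  have h := ModularForm.eta_comp_eq_csqrt_I_inv (x := τ) hτ
  simp only [Function.comp_apply, Pi.smul_apply, Pi.mul_apply, smul_eq_mul] at h
  have hs : ∀ z : ℂ, z ≠ 0 → Complex.sqrt z ^ 4 = z ^ 2 := by
    intro z hz
    rw [show 4 = 2 * 2 by norm_num, pow_mul]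
    simp [Complex.sqrt]
  have hτ0 : τ ≠ 0 := fun h0 => by simp [h0] at hτ
  rw [h, mul_pow, mul_pow, inv_pow, hs _ I_ne_zero, hs _ hτ0, I_sq]
  ring

lemma neg_one_div_im_pos {τ : ℂ} (hτ : 0 < τ.im) : 0 < (-1 / τ).im := by
  have hτ0 : τ ≠ 0 := fun h0 => by simp [h0] at hτ
  have := normSq_pos.mpr hτ0
  rw [neg_div, one_div, neg_im, inv_im, neg_div, neg_neg]
  positivity

/-- By the transformation law of `η ^ 4` the two sides have the same derivative, and they agree at
the fixed point `i`, whose value was normalised to `1 / 2`. -/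
lemma dev_neg_inv {τ : ℂ} (hτ : 0 < τ.im) : dev (-1 / τ) = 1 - dev τ := by
  refine eqOn_of_hasDerivAt (f := fun τ => dev (-1 / τ)) (g := fun τ => 1 - dev τ)
    (f' := fun τ => -(devFactor * ModularForm.eta τ ^ 4)) (s := {τ : ℂ | 0 < τ.im})
    (isOpen_lt continuous_const continuous_im) (convex_halfSpace_im_gt 0).isPreconnected
    (fun x hx => ?_) (fun x hx => ?_) (x := I) (by simp) ?_ hτ
  · have hx0 : x ≠ 0 := fun h0 => by simp [h0] at hx
    have hd : HasDerivAt (fun z : ℂ => -1 / z) (1 / x ^ 2) x := by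
      have h := (hasDerivAt_inv hx0).neg
      convert! h using 1
      · ext z; simp [neg_div]
      · simp
    have h := (hasDerivAt_dev (neg_one_div_im_pos hx)).comp x hd
    convert! h using 1
    rw [eta_pow_four_neg_inv hx]
    field_simp
  · exact (hasDerivAt_dev hx).const_sub 1
  · have : (-1 / I : ℂ) = I := by rw [neg_div, one_div, inv_I, neg_neg]
    simp only [this, dev_I]
    norm_num

/-! ### Equivariance of the developing map -/

/-- The modular transformation `γ` corresponds under the developing map to the Euclidean motion
`z ↦ a z + l`, and `a` is also the factor of automorphy of `η ^ 4` for `γ`. -/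
structure Develops (γ : SL(2, ℤ)) (a : Circle) (l : ℂ) : Prop where
  mem_sixth : a ∈ sixth
  mem_lattice : l ∈ lattice
  dev_smul : ∀ τ : ℍ, dev (γ • τ : ℍ) = a * dev τ + l
  eta_smul : ∀ τ : ℍ, ModularForm.eta (γ • τ : ℍ) ^ 4 =
    a * UpperHalfPlane.denom γ τ ^ 2 * ModularForm.eta τ ^ 4

lemma denom_mul (g h : SL(2, ℤ)) (τ : ℍ) :
    UpperHalfPlane.denom ((g * h : SL(2, ℤ)) : GL (Fin 2) ℝ) (τ : ℂ) =
      UpperHalfPlane.denom g (h • τ : ℍ) * UpperHalfPlane.denom h τ := by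
  rw [map_mul, map_mul, UpperHalfPlane.denom_cocycle _ _ τ.im_ne_zero,
    ModularGroup.sl_moeb, UpperHalfPlane.coe_smul_of_det_pos (by simp)]

lemma develops_one : Develops 1 1 0 where
  mem_sixth := one_mem _
  mem_lattice := zero_mem _
  dev_smul τ := by simp
  eta_smul τ := by simp

lemma Develops.mul {g h : SL(2, ℤ)} {a b : Circle} {l m : ℂ} (hg : Develops g a l)
    (hh : Develops h b m) : Develops (g * h) (a * b) (a * m + l) where
  mem_sixth := mul_mem hg.mem_sixth hh.mem_sixth
  mem_lattice := add_mem (sixth_mul_mem_lattice hg.mem_sixth hh.mem_lattice) hg.mem_lattice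
  dev_smul τ := by
    rw [mul_smul, hg.dev_smul, hh.dev_smul]
    push_cast
    ring
  eta_smul τ := by
    rw [denom_mul, mul_smul, hg.eta_smul, hh.eta_smul]
    push_cast
    ring

lemma Develops.inv {g : SL(2, ℤ)} {a : Circle} {l : ℂ} (hg : Develops g a l) :
    Develops g⁻¹ a⁻¹ (-((a⁻¹ : Circle) * l)) where
  mem_sixth := inv_mem hg.mem_sixth
  mem_lattice := neg_mem (sixth_mul_mem_lattice (inv_mem hg.mem_sixth) hg.mem_lattice)
  dev_smul τ := by
    have h := hg.dev_smul (g⁻¹ • τ)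
    rw [smul_inv_smul] at h
    rw [h, Circle.coe_inv]
    field_simp
    ring
  eta_smul τ := by
    have h := hg.eta_smul (g⁻¹ • τ)
    have hd := denom_mul g g⁻¹ τ
    rw [mul_inv_cancel, map_one, map_one, UpperHalfPlane.denom_one] at hd
    rw [smul_inv_smul] at h
    rw [h, Circle.coe_inv]
    field_simp
    linear_combination ((ModularForm.eta (g⁻¹ • τ : ℍ) ^ 4) *
      (1 + UpperHalfPlane.denom g (g⁻¹ • τ : ℍ) * UpperHalfPlane.denom (g⁻¹ : SL(2, ℤ)) τ)) * hd

lemma coe_T_smul (τ : ℍ) : ((ModularGroup.T • τ : ℍ) : ℂ) = τ + 1 := by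
  rw [UpperHalfPlane.modular_T_smul, UpperHalfPlane.coe_vadd, add_comm, ofReal_one]

lemma coe_S_smul (τ : ℍ) : ((ModularGroup.S • τ : ℍ) : ℂ) = -1 / τ := by
  rw [UpperHalfPlane.modular_S_smul, UpperHalfPlane.coe_mk, inv_neg, neg_div, one_div]

lemma develops_T : Develops ModularGroup.T zeta 0 where
  mem_sixth := Subgroup.mem_zpowers zeta
  mem_lattice := zero_mem _
  dev_smul τ := by rw [coe_T_smul, dev_add_one τ.im_pos, add_zero]
  eta_smul τ := by
    have : UpperHalfPlane.denom (ModularGroup.T : SL(2, ℤ)) τ = 1 := by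
      rw [ModularGroup.denom_apply]; simp [ModularGroup.T]
    rw [coe_T_smul, eta_pow_four_add_one, this]
    ring

lemma develops_S : Develops ModularGroup.S (zeta ^ 3) 1 where
  mem_sixth := pow_mem (Subgroup.mem_zpowers zeta) 3
  mem_lattice := one_mem_lattice
  dev_smul τ := by
    rw [coe_S_smul, dev_neg_inv τ.im_pos, Circle.coe_pow, zeta_cube]
    ring
  eta_smul τ := by
    rw [coe_S_smul, eta_pow_four_neg_inv τ.im_pos, ModularGroup.denom_S, Circle.coe_pow,
      zeta_cube]
    ring

/-- Every modular transformation corresponds to a motion that preserves the tiling. -/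
lemma exists_develops (γ : SL(2, ℤ)) : ∃ a l, Develops γ a l := by
  have hγ : γ ∈ Subgroup.closure {ModularGroup.S, ModularGroup.T} := by
    rw [SpecialLinearGroup.SL2Z_generators]
    trivial
  induction hγ using Subgroup.closure_induction with
  | mem g hg =>
    rcases hg with rfl | rfl
    · exact ⟨_, _, develops_S⟩
    · exact ⟨_, _, develops_T⟩
  | one => exact ⟨_, _, develops_one⟩
  | mul g h _ _ hg hh =>
    obtain ⟨a, l, hg⟩ := hg
    obtain ⟨b, m, hh⟩ := hh
    exact ⟨_, _, hg.mul hh⟩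
  | inv g _ hg =>
    obtain ⟨a, l, hg⟩ := hg
    exact ⟨_, _, hg.inv⟩

/-! ### The image of the fundamental domain -/

/-- The part of the strip of width one centred at the imaginary axis above the height `√3 / 2`. -/
def strip : Set ℂ := {τ | |τ.re| ≤ 1 / 2 ∧ 3 ≤ 4 * τ.im ^ 2 ∧ 0 < τ.im}

lemma mem_strip_of_mem_fd {τ : ℍ} (hτ : τ ∈ ModularGroup.fd) : (τ : ℂ) ∈ strip :=
  ⟨hτ.2, ModularGroup.three_le_four_mul_im_sq_of_mem_fd hτ, τ.im_pos⟩

lemma norm_cuspCoord_le_of_mem_strip {τ : ℂ} (hτ : τ ∈ strip) : ‖cuspCoord τ‖ ≤ 9 / 20 :=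
  norm_cuspCoord_le hτ.2.1 hτ.2.2

lemma prim_injOn {s t : ℂ} (hs : ‖s‖ ≤ 9 / 20) (ht : ‖t‖ ≤ 9 / 20) (h : prim s = prim t) :
    s = t := by
  have h1 := norm_prim_sub_sub_le hs ht
  rw [h, sub_self, zero_sub, norm_neg] at h1
  have h2 : ‖t - s‖ = 0 := le_antisymm (by linarith) (norm_nonneg _)
  exact (sub_eq_zero.mp (norm_eq_zero.mp h2)).symm

/-- On the strip `prim` is injective in the cusp coordinate, and the cusp coordinate has period `6`
while the strip has width `1`. -/
lemma dev_injOn_strip : Set.InjOn dev strip := by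
  intro σ hσ τ hτ h
  have hs : (scale : ℂ) ≠ 0 := ofReal_ne_zero.mpr scale_pos.ne'
  have h1 := prim_injOn (norm_cuspCoord_le_of_mem_strip hσ) (norm_cuspCoord_le_of_mem_strip hτ)
    (mul_left_cancel₀ hs h)
  obtain ⟨n, hn⟩ := exp_eq_exp_iff_exists_int.mp h1
  have hpi : (Real.pi : ℂ) ≠ 0 := ofReal_ne_zero.mpr Real.pi_ne_zero
  have hn' : σ = τ + 6 * n := by
    have : ((Real.pi : ℂ) * I) * (σ - (τ + 6 * n)) = 0 := by
      push_cast at hn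
      linear_combination 3 * hn
    rcases mul_eq_zero.mp this with h0 | h0
    · exact absurd h0 (mul_ne_zero hpi I_ne_zero)
    · exact sub_eq_zero.mp h0
  have hre : σ.re = τ.re + 6 * n := by rw [hn']; simp
  have h3 := abs_le.mp hσ.1
  have h4 := abs_le.mp hτ.1
  have : n = 0 := by
    have ha : (n : ℝ) < 1 := by linarith
    have hb : (-1 : ℝ) < n := by linarith
    have ha' : n < 1 := by exact_mod_cast ha
    have hb' : -1 < n := by exact_mod_cast hb
    omega
  rw [hn', this]
  simp

lemma cuspCoord_re (τ : ℂ) :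
    (cuspCoord τ).re = ‖cuspCoord τ‖ * Real.cos (Real.pi / 3 * τ.re) := by
  rw [norm_cuspCoord, cuspCoord, exp_re]
  simp

lemma cuspCoord_im (τ : ℂ) :
    (cuspCoord τ).im = ‖cuspCoord τ‖ * Real.sin (Real.pi / 3 * τ.re) := by
  rw [norm_cuspCoord, cuspCoord, exp_im]
  simp

/-- The argument of the cusp coordinate is at most `π / 6` in absolute value. The constant `1 / 2`
is chosen to beat the error factor in `norm_prim_sub_sub_le`. -/
lemma half_norm_lt_cuspCoord_re {τ : ℂ} (hτ : |τ.re| ≤ 1 / 2) :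
    1 / 2 * ‖cuspCoord τ‖ < (cuspCoord τ).re := by
  have hpos : 0 < ‖cuspCoord τ‖ := norm_pos_iff.mpr (cuspCoord_ne_zero _)
  have hcos : 1 / 2 < Real.cos (Real.pi / 3 * τ.re) := by
    rw [← Real.cos_pi_div_three, ← Real.cos_abs (Real.pi / 3 * τ.re)]
    have hpi := Real.pi_pos
    apply Real.cos_lt_cos_of_nonneg_of_le_pi (abs_nonneg _) (by linarith)
    rw [abs_mul, abs_of_pos (by positivity)]
    nlinarith
  rw [cuspCoord_re]
  nlinarith

lemma dev_re (τ : ℂ) : (dev τ).re = scale * (prim (cuspCoord τ)).re := by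
  rw [dev, re_ofReal_mul]

lemma dev_im (τ : ℂ) : (dev τ).im = scale * (prim (cuspCoord τ)).im := by
  rw [dev, im_ofReal_mul]

lemma dev_re_pos {τ : ℂ} (hτ : τ ∈ strip) : 0 < (dev τ).re := by
  have h := norm_prim_sub_sub_le (s := 0) (by norm_num) (norm_cuspCoord_le_of_mem_strip hτ)
  rw [prim_zero, sub_zero, sub_zero] at h
  have h2 := (abs_le.mp ((abs_re_le_norm _).trans h)).1
  rw [sub_re] at h2
  have h3 := half_norm_lt_cuspCoord_re hτ.1
  rw [dev_re]
  exact mul_pos scale_pos (by linarith)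

/-- The real part of the developing map decreases along vertical half lines. -/
lemma dev_re_lt {σ τ : ℂ} (hσ : σ ∈ strip) (hτ : τ ∈ strip) (hre : σ.re = τ.re)
    (him : σ.im < τ.im) : (dev τ).re < (dev σ).re := by
  have h := norm_prim_sub_sub_le (norm_cuspCoord_le_of_mem_strip hτ)
    (norm_cuspCoord_le_of_mem_strip hσ)
  have hr : cuspCoord σ = (Real.exp (Real.pi / 3 * (τ.im - σ.im)) : ℝ) * cuspCoord τ := by
    rw [cuspCoord, cuspCoord, ofReal_exp, ← exp_add]
    congr 1
    apply Complex.ext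
    · simp
      ring
    · simp [hre]
  set r := Real.exp (Real.pi / 3 * (τ.im - σ.im))
  have hr1 : 1 < r := by
    apply Real.one_lt_exp_iff.mpr
    have := Real.pi_pos
    have : 0 < τ.im - σ.im := by linarith
    positivity
  have hd : cuspCoord σ - cuspCoord τ = (r - 1 : ℝ) * cuspCoord τ := by
    rw [hr]; push_cast; ring
  rw [hd, norm_mul, norm_real, Real.norm_eq_abs, abs_of_pos (by linarith)] at h
  have h2 := (abs_le.mp ((abs_re_le_norm _).trans h)).1
  rw [sub_re, sub_re, re_ofReal_mul] at h2
  have h3 := half_norm_lt_cuspCoord_re hτ.1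
  rw [dev_re, dev_re]
  apply mul_lt_mul_of_pos_left _ scale_pos
  nlinarith

/-- On the unit circle `-1 / τ` equals `-conj τ`, so the half-turn about `1 / 2` and complex
conjugation have the same effect on the value. -/
lemma dev_re_of_norm_eq_one {τ : ℂ} (hτ : 0 < τ.im) (h1 : normSq τ = 1) : (dev τ).re = 1 / 2 := by
  have h : -1 / τ = -conj τ := by
    rw [neg_div, one_div, inv_def, h1]
    simp
  have h2 := dev_neg_inv hτ
  rw [h, dev_neg_conj hτ] at h2
  have h3 := congrArg re h2
  rw [conj_re, sub_re, one_re] at h3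
  linarith

lemma dev_re_le {τ : ℍ} (hτ : τ ∈ ModularGroup.fd) :
    (dev τ).re ≤ 1 / 2 ∧ ((dev τ).re = 1 / 2 → normSq τ = 1) := by
  obtain ⟨h1, h2⟩ := hτ
  have hx : τ.re ^ 2 ≤ 1 / 4 := by
    rw [← sq_abs]
    nlinarith [abs_nonneg τ.re]
  rcases h1.eq_or_lt with h1 | h1
  · exact ⟨(dev_re_of_norm_eq_one τ.im_pos h1.symm).le, fun _ => h1.symm⟩
  · have hσ : √(1 - τ.re ^ 2) ^ 2 = 1 - τ.re ^ 2 := Real.sq_sqrt (by linarith)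
    have hσ0 : 0 < √(1 - τ.re ^ 2) := Real.sqrt_pos.mpr (by linarith)
    -- This is the point of the unit circle vertically below `τ`; the real part of `dev` equals `1 /
    -- 2` there and decreases upwards.
    set σ : ℂ := ⟨τ.re, √(1 - τ.re ^ 2)⟩
    have hσs : σ ∈ strip := ⟨h2, by change 3 ≤ 4 * √(1 - τ.re ^ 2) ^ 2; linarith, hσ0⟩
    have hlt : σ.im < (τ : ℂ).im := by
      change √(1 - τ.re ^ 2) < τ.im
      apply lt_of_pow_lt_pow_left₀ 2 τ.im_pos.le
      rw [normSq_apply] at h1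
      change 1 < τ.re * τ.re + τ.im * τ.im at h1
      nlinarith
    have h3 := dev_re_lt hσs (mem_strip_of_mem_fd ⟨h1.le, h2⟩) rfl hlt
    have h4 : normSq σ = 1 := by
      rw [normSq_apply]
      change τ.re * τ.re + √(1 - τ.re ^ 2) * √(1 - τ.re ^ 2) = 1
      nlinarith
    rw [dev_re_of_norm_eq_one hσ0 h4] at h3
    exact ⟨h3.le, fun h => absurd h h3.ne⟩

/-- The imaginary part of `exp (- π i / 6) z`. -/
lemma im_rotate_sixth (z : ℂ) :
    (exp ((-(Real.pi / 6) : ℝ) * I) * z).im = (√3 * z.im - z.re) / 2 := by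
  rw [mul_im, exp_ofReal_mul_I_re, exp_ofReal_mul_I_im, Real.cos_neg, Real.sin_neg,
    Real.cos_pi_div_six, Real.sin_pi_div_six]
  ring

/-- The function `prim` commutes with the reflection in the line through `0` of angle `π / 6`, hence
preserves that line. Comparing `t` with its orthogonal projection `s` to the line, the error of
`prim t - prim s` is at most half of `|t - s|`, so `prim t` stays on the same side as `t`. Equality
forces `t` onto the line, that is, `τ.re = 1 / 2`. -/
lemma dev_im_le {τ : ℂ} (hτ : τ ∈ strip) :
    √3 * (dev τ).im ≤ (dev τ).re ∧ (√3 * (dev τ).im = (dev τ).re → τ.re = 1 / 2) := by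
  set ω : ℂ := exp ((-(Real.pi / 6) : ℝ) * I) with hω
  set ω' : ℂ := exp ((Real.pi / 6 : ℝ) * I) with hω'
  have hωω : ω' * ω = 1 := by rw [hω, hω', ← exp_add]; simp
  have hω2 : ω' * ω' = zeta := by
    rw [coe_zeta, hω', ← exp_add]; congr 1; push_cast; ring
  have hconj : conj ω' = ω := by
    rw [hω, hω', ← exp_conj, map_mul, conj_ofReal, conj_I]; congr 1; push_cast; ring
  have hnω : ‖ω‖ = 1 := norm_exp_ofReal_mul_I _
  have hnω' : ‖ω'‖ = 1 := norm_exp_ofReal_mul_I _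
  set t := cuspCoord τ with ht
  have htn : ‖t‖ ≤ 9 / 20 := norm_cuspCoord_le_of_mem_strip hτ
  set b := ω * t with hb
  have hbs : b = cuspCoord (τ - (1 / 2 : ℝ)) := by
    rw [hb, ht, cuspCoord, cuspCoord, hω, ← exp_add]; congr 1; push_cast; ring
  set s := ω' * (b.re : ℂ) with hs
  have hsn : ‖s‖ ≤ 9 / 20 := by
    rw [hs, norm_mul, hnω', one_mul, norm_real]
    refine (abs_re_le_norm b).trans ?_
    rw [hb, norm_mul, hnω, one_mul]
    exact htn
  have hs1 : ‖s‖ < 1 := hsn.trans_lt (by norm_num)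
  -- The map `z ↦ zeta * conj z` is the reflection in the line spanned by `ω'`.
  have hsc : (zeta : ℂ) * conj s = s := by
    rw [hs, map_mul, conj_ofReal, hconj, ← hω2]
    linear_combination (ω' * b.re) * hωω
  have hprim : prim s = zeta * conj (prim s) := by
    rw [← prim_conj hs1, ← prim_mul_of_pow_six zeta_pow_six' (by rwa [norm_conj]), hsc]
  have hzero : √3 * (prim s).im - (prim s).re = 0 := by
    have h1 := congrArg re hprim
    rw [mul_re, conj_re, conj_im, zeta_re, zeta_im] at h1
    linarith
  have hts : ω * (t - s) = (b.im : ℂ) * I := by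
    have hbb := re_add_im b
    rw [mul_sub, ← hb, hs]
    linear_combination -hbb - (b.re : ℂ) * hωω
  have h := norm_prim_sub_sub_le hsn htn
  have hnts : ‖t - s‖ = |b.im| := by
    rw [← one_mul ‖t - s‖, ← hnω, ← norm_mul, hts, norm_mul, norm_I, mul_one, norm_real,
      Real.norm_eq_abs]
  have h2 : |(ω * (prim t - prim s - (t - s))).im| ≤ 1 / 2 * |b.im| := by
    refine (abs_im_le_norm _).trans ?_
    rw [norm_mul, hnω, one_mul, ← hnts]
    exact h
  rw [mul_sub, hts, sub_im, im_rotate_sixth, sub_re, sub_im, im_ofReal_mul, I_im, mul_one] at h2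
  have h3 := (abs_le.mp h2).2
  have hbim : b.im = ‖b‖ * Real.sin (Real.pi / 3 * (τ.re - 1 / 2)) := by
    rw [hbs, cuspCoord_im, sub_re, ofReal_re]
  have hbn : 0 < ‖b‖ := by
    rw [hbs]; exact norm_pos_iff.mpr (cuspCoord_ne_zero _)
  have hre := abs_le.mp hτ.1
  have hpi := Real.pi_pos
  have hneg : τ.re < 1 / 2 → b.im < 0 := by
    intro hlt
    rw [hbim]
    refine mul_neg_of_pos_of_neg hbn (Real.sin_neg_of_neg_of_neg_pi_lt ?_ ?_) <;> nlinarith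
  have hlin : √3 * (dev τ).im - (dev τ).re = scale * (√3 * (prim t).im - (prim t).re) := by
    rw [dev_re, dev_im]; ring
  have hsp := scale_pos
  rcases hre.2.eq_or_lt with heq | hlt
  · refine ⟨?_, fun _ => heq⟩
    have hb0 : b.im = 0 := by rw [hbim, heq]; simp
    rw [hb0, abs_zero] at h3
    have : scale * (√3 * (prim t).im - (prim t).re) ≤ 0 :=
      mul_nonpos_of_nonneg_of_nonpos hsp.le (by linarith)
    linarith
  · have hb0 := hneg hlt
    rw [abs_of_neg hb0] at h3
    have : scale * (√3 * (prim t).im - (prim t).re) < 0 :=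
      mul_neg_of_pos_of_neg hsp (by linarith)
    exact ⟨by linarith, fun h => by linarith⟩

/-- Mirror image of `dev_im_le` under `τ ↦ -conj τ`. -/
lemma neg_dev_im_le {τ : ℂ} (hτ : τ ∈ strip) :
    -(√3 * (dev τ).im) ≤ (dev τ).re ∧ (-(√3 * (dev τ).im) = (dev τ).re → τ.re = -1 / 2) := by
  have hτ' : -conj τ ∈ strip := by
    refine ⟨?_, ?_, ?_⟩
    · rw [neg_re, conj_re, abs_neg]; exact hτ.1
    · rw [neg_im, conj_im, neg_neg]; exact hτ.2.1
    · rw [neg_im, conj_im, neg_neg]; exact hτ.2.2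
  have h := dev_im_le hτ'
  rw [dev_neg_conj hτ.2.2, conj_re, conj_im, neg_re, conj_re] at h
  refine ⟨by linarith [h.1], fun h0 => ?_⟩
  have := h.2 (by linarith)
  linarith

/-! ### One sixth of the Voronoi cell of the vertex `0`. -/

/-- The triangle with vertices at the origin and at the centres of the two tiles on both sides of
the edge from `0` to `1`, without the origin. -/
def kite : Set ℂ := {z | 0 < z.re ∧ z.re ≤ 1 / 2 ∧ √3 * z.im ≤ z.re ∧ -(√3 * z.im) ≤ z.re}

lemma dev_mem_kite {τ : ℍ} (hτ : τ ∈ ModularGroup.fd) : dev τ ∈ kite :=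
  ⟨dev_re_pos (mem_strip_of_mem_fd hτ), (dev_re_le hτ).1, (dev_im_le (mem_strip_of_mem_fd hτ)).1,
    (neg_dev_im_le (mem_strip_of_mem_fd hτ)).1⟩

lemma three_mul_im_sq_le {w : ℂ} (hw : w ∈ kite) : 3 * w.im ^ 2 ≤ w.re ^ 2 := by
  obtain ⟨h1, h2, h3, h4⟩ := hw
  have h := sqrt_three_mul_self
  have := sq_le_sq.mpr (abs_le_abs h3 h4)
  nlinarith

/-- Cauchy–Schwarz with `normSq w ≤ 1 / 3`, the squared circumradius of a tile. It settles all
lattice vectors except the six shortest ones. -/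
lemma re_mul_conj_sq_le {w l : ℂ} (hw : w ∈ kite) : (2 * (w * conj l).re) ^ 2 ≤ 4 / 3 * normSq l := by
  have h := three_mul_im_sq_le hw
  obtain ⟨h1, h2, -, -⟩ := hw
  have hc : (w * conj l).re ^ 2 ≤ normSq w * normSq l := by
    rw [mul_re, conj_re, conj_im, normSq_apply, normSq_apply]
    nlinarith [sq_nonneg (w.re * l.im - w.im * l.re)]
  have hw3 : normSq w ≤ 1 / 3 := by rw [normSq_apply]; nlinarith
  nlinarith [normSq_nonneg l]

/-- The term with real parts is nonpositive, and `|w.im|` is at most `1 / √12 < 1 / 2`. -/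
lemma re_mul_conj_lt_half {w l : ℂ} (hw : w ∈ kite) (hl : normSq l = 1) (hre : l.re ≤ 0) :
    2 * (w * conj l).re < 1 := by
  have h := three_mul_im_sq_le hw
  obtain ⟨h1, h2, -, -⟩ := hw
  rw [mul_re, conj_re, conj_im]
  rw [normSq_apply] at hl
  have him : (w.im * l.im) ^ 2 ≤ 1 / 12 := by
    have h3 : l.im ^ 2 ≤ 1 := by nlinarith
    have h4 : w.im ^ 2 ≤ 1 / 12 := by nlinarith
    rw [mul_pow]
    nlinarith [sq_nonneg w.im, sq_nonneg l.im]
  have : w.im * l.im < 1 / 2 := by nlinarith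
  nlinarith

lemma mul_conj_zeta_re (w : ℂ) : 2 * (w * conj (zeta : ℂ)).re = w.re + √3 * w.im := by
  rw [mul_re, conj_re, conj_im, zeta_re, zeta_im]; ring

lemma mul_conj_zeta_inv_re (w : ℂ) : 2 * (w * conj (1 - zeta : ℂ)).re = w.re - √3 * w.im := by
  rw [← conj_zeta, conj_conj, mul_re, zeta_re, zeta_im]; ring

/-- The points of the kite are at least as close to the origin as to any other vertex. -/
lemma re_mul_conj_le_of_mem_kite {w l : ℂ} (hw : w ∈ kite) (hl : l ∈ lattice) :
    2 * (w * conj l).re ≤ normSq l := by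
  rcases eq_or_ne l 0 with rfl | h0
  · simp
  rcases lt_or_ge (normSq l) 3 with h3 | h3
  · have h1 := normSq_eq_one_of_lt_three hl h0 h3
    rw [h1]
    rcases le_or_gt l.re 0 with hre | hre
    · exact (re_mul_conj_lt_half hw h1 hre).le
    · obtain ⟨ha, hb, hc, hd⟩ := hw
      rcases eq_of_normSq_eq_one hl h1 hre with rfl | rfl | rfl
      · rw [map_one, mul_one]; linarith
      · rw [mul_conj_zeta_re]; linarith
      · rw [mul_conj_zeta_inv_re]; linarith
  · have h := re_mul_conj_sq_le (l := l) hw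
    nlinarith

lemma normSq_le_normSq_sub {w l : ℂ} (hw : w ∈ kite) (hl : l ∈ lattice) :
    normSq w ≤ normSq (w - l) := by
  have := re_mul_conj_le_of_mem_kite hw hl
  rw [normSq_sub]
  linarith

lemma notMem_lattice_of_mem_kite {w : ℂ} (hw : w ∈ kite) : w ∉ lattice := by
  intro hl
  have h := normSq_le_normSq_sub hw hl
  rw [sub_self, normSq_zero] at h
  have h0 := normSq_eq_zero.mp (le_antisymm h (normSq_nonneg w))
  have := hw.1
  rw [h0] at this
  exact lt_irrefl _ this

/-- Equality means that `w` is as close to `l` as to `0`. Only the right-hand side of the triangle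
has such points, and for the neighbours `zeta` and `1 - zeta` only its two ends, the centres of the
adjacent tiles. -/
lemma eq_of_re_mul_conj_eq {w l : ℂ} (hw : w ∈ kite) (hl : l ∈ lattice) (h0 : l ≠ 0)
    (h : 2 * (w * conj l).re = normSq l) :
    w.re = 1 / 2 ∧ (l = 1 ∨ l = zeta ∧ √3 * w.im = w.re ∨
      l = 1 - zeta ∧ -(√3 * w.im) = w.re) := by
  have h1 : normSq l = 1 := by
    have h2 := re_mul_conj_sq_le (l := l) hw
    have h3 := normSq_pos.mpr h0
    refine normSq_eq_one_of_lt_three hl h0 ?_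
    rw [h] at h2
    nlinarith
  have hre : 0 < l.re := by
    by_contra hre
    have := re_mul_conj_lt_half hw h1 (not_lt.mp hre)
    linarith
  obtain ⟨ha, hb, hc, hd⟩ := hw
  rw [h1] at h
  rcases eq_of_normSq_eq_one hl h1 hre with rfl | rfl | rfl
  · rw [map_one, mul_one] at h
    exact ⟨by linarith, Or.inl rfl⟩
  · rw [mul_conj_zeta_re] at h
    exact ⟨by linarith, Or.inr (Or.inl ⟨rfl, by linarith⟩)⟩
  · rw [mul_conj_zeta_inv_re] at h
    exact ⟨by linarith, Or.inr (Or.inr ⟨rfl, by linarith⟩)⟩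

/-! ### Points with equivalent images -/

lemma normSq_coe_eq (τ : ℍ) : normSq (τ : ℂ) = τ.re ^ 2 + τ.im ^ 2 := by
  rw [normSq_apply, sq, sq]; rfl

lemma develops_T_inv : Develops ModularGroup.T⁻¹ zeta⁻¹ 0 := by
  simpa using develops_T.inv

lemma S_smul_mem_fd {τ : ℍ} (hτ : τ ∈ ModularGroup.fd) (h1 : normSq (τ : ℂ) = 1) :
    ModularGroup.S • τ ∈ ModularGroup.fd := by
  have h : ((ModularGroup.S • τ : ℍ) : ℂ) = -conj (τ : ℂ) := by
    rw [coe_S_smul, neg_div, one_div, inv_def, h1]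
    simp
  refine ⟨?_, ?_⟩
  · rw [h, normSq_neg, normSq_conj, h1]
  · have h2 := congrArg re h
    rw [neg_re, conj_re] at h2
    change |((ModularGroup.S • τ : ℍ) : ℂ).re| ≤ 1 / 2
    rw [h2, abs_neg]
    exact hτ.2

/-- If the image of a point of the fundamental domain is on the perpendicular bisector between `0`
and the lattice point `l`, then a power of the translation moves the point to the unit circle. -/
lemma exists_translate_of_re_mul_conj_eq {τ : ℍ} (hτ : τ ∈ ModularGroup.fd) {l : ℂ}
    (hl : l ∈ lattice) (h0 : l ≠ 0) (h : 2 * (dev τ * conj l).re = normSq l) :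
    ∃ (σ : SL(2, ℤ)) (b : Circle), l = b ∧ Develops σ b⁻¹ 0 ∧ σ • τ ∈ ModularGroup.fd ∧
      normSq ((σ • τ : ℍ) : ℂ) = 1 := by
  obtain ⟨hre, hcase⟩ := eq_of_re_mul_conj_eq (dev_mem_kite hτ) hl h0 h
  have h1 := (dev_re_le hτ).2 hre
  have hs := mem_strip_of_mem_fd hτ
  rcases hcase with rfl | ⟨rfl, him⟩ | ⟨rfl, him⟩
  · exact ⟨1, 1, by simp, by simpa using develops_one, by simpa using hτ, by simpa using h1⟩
  · have hx : τ.re = 1 / 2 := (dev_im_le hs).2 him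
    have hn : normSq ((ModularGroup.T⁻¹ • τ : ℍ) : ℂ) = 1 := by
      rw [normSq_coe_eq] at h1 ⊢
      rw [ModularGroup.re_T_inv_smul, ModularGroup.im_T_inv_smul, hx]
      rw [hx] at h1
      linarith
    refine ⟨ModularGroup.T⁻¹, zeta, rfl, develops_T_inv, ⟨hn.ge, ?_⟩, hn⟩
    rw [ModularGroup.re_T_inv_smul, hx]
    norm_num [abs_of_neg]
  · have hx : τ.re = -1 / 2 := (neg_dev_im_le hs).2 him
    have hn : normSq ((ModularGroup.T • τ : ℍ) : ℂ) = 1 := by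
      rw [normSq_coe_eq] at h1 ⊢
      rw [ModularGroup.re_T_smul, ModularGroup.im_T_smul, hx]
      rw [hx] at h1
      linarith
    refine ⟨ModularGroup.T, zeta⁻¹, zeta_inv.symm, by simpa using develops_T, ⟨hn.ge, ?_⟩, hn⟩
    rw [ModularGroup.re_T_smul, hx]
    norm_num

/-- The kite lies in the sector of angles between `-π / 6` and `π / 6`, which meets its rotation by
`π / 3` only along a bounding ray. So `dev σ` is on the lower ray and `σ.re = -1 / 2`, whence `T •
σ` is still in the strip, where `dev` is injective. -/
lemma T_smul_eq_of_dev_eq {σ τ : ℍ} (hσ : σ ∈ ModularGroup.fd) (hτ : τ ∈ ModularGroup.fd)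
    (h : dev τ = zeta * dev σ) : ModularGroup.T • σ = τ := by
  have hw := dev_mem_kite hτ
  have hz := dev_mem_kite hσ
  have hs := mem_strip_of_mem_fd hσ
  have h3 := sqrt_three_mul_self
  have hre := congrArg re h
  have him := congrArg im h
  rw [mul_re, zeta_re, zeta_im] at hre
  rw [mul_im, zeta_re, zeta_im] at him
  have hx : σ.re = -1 / 2 := by
    refine (neg_dev_im_le hs).2 (le_antisymm (neg_dev_im_le hs).1 ?_)
    have := hw.2.2.1
    rw [hre, him] at this
    linear_combination this - (dev σ).re / 2 * h3
  apply UpperHalfPlane.ext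
  refine dev_injOn_strip ?_ (mem_strip_of_mem_fd hτ) ?_
  · refine ⟨?_, ?_, UpperHalfPlane.im_pos _⟩
    · change |(ModularGroup.T • σ : ℍ).re| ≤ 1 / 2
      rw [ModularGroup.re_T_smul, hx]
      norm_num
    · change 3 ≤ 4 * (ModularGroup.T • σ : ℍ).im ^ 2
      rw [ModularGroup.im_T_smul]
      exact hs.2.1
  · rw [develops_T.dev_smul, h, add_zero]

/-- Two points of the fundamental domain whose images differ by a sixth root of unity differ by a
translation. -/
lemma exists_develops_of_dev_eq_mul {τ₁ τ₂ : ℍ} (h₁ : τ₁ ∈ ModularGroup.fd)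
    (h₂ : τ₂ ∈ ModularGroup.fd) {a : Circle} (ha : a ∈ sixth) (h : dev τ₂ = a * dev τ₁) :
    ∃ γ, Develops γ a 0 ∧ γ • τ₁ = τ₂ := by
  obtain ⟨k, hk, rfl⟩ := exists_pow_of_mem_sixth ha
  have hw := dev_mem_kite h₂
  have hz := dev_mem_kite h₁
  have hzre := hz.1
  have hwre := hw.1
  have hz3 := hz.2.2.1
  have hz4 := hz.2.2.2
  rw [Circle.coe_pow] at h
  -- Rotations by `2π / 3`, `π` and `4π / 3` carry the sector out of the right half plane, so only
  -- the exponents `0`, `1` and `5` survive.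
  interval_cases k
  · refine ⟨1, by simpa using develops_one, ?_⟩
    rw [one_smul]
    apply UpperHalfPlane.ext
    refine dev_injOn_strip (mem_strip_of_mem_fd h₁) (mem_strip_of_mem_fd h₂) ?_
    rw [h, pow_zero, one_mul]
  · rw [pow_one] at h ⊢
    exact ⟨ModularGroup.T, develops_T, T_smul_eq_of_dev_eq h₁ h₂ h⟩
  · rw [h, zeta_sq, mul_re, sub_re, sub_im, zeta_re, zeta_im, one_re, one_im] at hwre
    linarith
  · rw [h, zeta_cube, neg_one_mul, neg_re] at hwre
    linarith
  · have : (zeta : ℂ) ^ 4 = -zeta := by linear_combination zeta * zeta_cube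
    rw [h, this, mul_re, neg_re, neg_im, zeta_re, zeta_im] at hwre
    linarith
  · have h5 : zeta ^ 5 = zeta⁻¹ := by
      rw [eq_inv_iff_mul_eq_one, ← pow_succ, zeta_pow_six]
    rw [h5]
    refine ⟨ModularGroup.T⁻¹, develops_T_inv, ?_⟩
    rw [inv_smul_eq_iff]
    refine (T_smul_eq_of_dev_eq h₂ h₁ ?_).symm
    rw [h, ← mul_assoc, ← pow_succ', zeta_pow_six', one_mul]

/-- For `l ≠ 0` both values are closest to the vertex `0`, which gives `|dev τ₂| ≤ |dev τ₂ - l| =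
|dev τ₁| ≤ |dev τ₁ - m| = |dev τ₂|`. Hence both lie on perpendicular bisectors; powers of `T` bring
both points to the unit circle and both lattice vectors to `1`, and there `S` carries one to the
other. -/
lemma exists_develops_of_mem_fd {τ₁ τ₂ : ℍ} (h₁ : τ₁ ∈ ModularGroup.fd)
    (h₂ : τ₂ ∈ ModularGroup.fd) {a : Circle} (ha : a ∈ sixth) {l : ℂ} (hl : l ∈ lattice)
    (h : dev τ₂ = a * dev τ₁ + l) : ∃ γ, Develops γ a l ∧ γ • τ₁ = τ₂ := by
  rcases eq_or_ne l 0 with rfl | hl0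
  · exact exists_develops_of_dev_eq_mul h₁ h₂ ha (by rw [h, add_zero])
  set m : ℂ := -((a⁻¹ : Circle) * l) with hm
  have hml : m ∈ lattice := neg_mem (sixth_mul_mem_lattice (inv_mem ha) hl)
  have hnorm (b : Circle) (z : ℂ) : normSq (b * z) = normSq z := by simp
  have e1 : dev τ₂ - l = a * dev τ₁ := by rw [h]; ring
  have e2 : dev τ₁ - m = (a⁻¹ : Circle) * dev τ₂ := by
    rw [h, hm, Circle.coe_inv]
    field_simp
    ring
  have n1 := normSq_le_normSq_sub (dev_mem_kite h₂) hl
  have n2 := normSq_le_normSq_sub (dev_mem_kite h₁) hml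
  rw [e1, hnorm] at n1
  rw [e2, hnorm] at n2
  have f1 : 2 * (dev τ₂ * conj l).re = normSq l := by
    have := normSq_sub (dev τ₂) l
    rw [e1, hnorm] at this
    linarith
  have f2 : 2 * (dev τ₁ * conj m).re = normSq m := by
    have := normSq_sub (dev τ₁) m
    rw [e2, hnorm] at this
    linarith
  have hm0 : m ≠ 0 := by
    rw [hm, neg_ne_zero]
    exact mul_ne_zero (Circle.coe_ne_zero _) hl0
  obtain ⟨σ₂, b₂, hb₂, hd₂, hf₂, hc₂⟩ := exists_translate_of_re_mul_conj_eq h₂ hl hl0 f1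
  obtain ⟨σ₁, b₁, hb₁, hd₁, hf₁, hc₁⟩ := exists_translate_of_re_mul_conj_eq h₁ hml hm0 f2
  have hab : (b₂ : ℂ) = -(a * b₁) := by
    rw [← hb₁, ← hb₂, hm, Circle.coe_inv]
    field_simp
  have hab' : a = b₂ * zeta ^ 3 * b₁⁻¹ := by
    apply Circle.coe_injective
    push_cast
    rw [hab, zeta_cube]
    field_simp
  have hdev := (hd₂.inv.mul (develops_S.mul hd₁))
  refine ⟨σ₂⁻¹ * (ModularGroup.S * σ₁), ?_, ?_⟩
  · convert hdev using 1
    · rw [hab']; group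
    · rw [hb₂]; simp
  · rw [mul_smul, mul_smul, inv_smul_eq_iff]
    apply UpperHalfPlane.ext
    refine dev_injOn_strip (mem_strip_of_mem_fd (S_smul_mem_fd hf₁ hc₁))
      (mem_strip_of_mem_fd hf₂) ?_
    rw [develops_S.dev_smul, hd₁.dev_smul, hd₂.dev_smul, h, hb₂, Circle.coe_pow, zeta_cube, hab']
    push_cast
    rw [zeta_cube]
    field_simp
    ring

/-- Two points of the upper half plane whose images under the developing map are equivalent under
a motion of the tiling are equivalent under the modular transformation that develops into that
motion. -/
theorem exists_develops_of_dev_eq {τ₁ τ₂ : ℍ} {a : Circle} (ha : a ∈ sixth) {l : ℂ}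
    (hl : l ∈ lattice) (h : dev τ₂ = a * dev τ₁ + l) : ∃ γ, Develops γ a l ∧ γ • τ₁ = τ₂ := by
  obtain ⟨g₁, hg₁⟩ := ModularGroup.exists_smul_mem_fd τ₁
  obtain ⟨g₂, hg₂⟩ := ModularGroup.exists_smul_mem_fd τ₂
  obtain ⟨a₁, l₁, d₁⟩ := exists_develops g₁
  obtain ⟨a₂, l₂, d₂⟩ := exists_develops g₂
  obtain ⟨γ, d, hγ⟩ := exists_develops_of_mem_fd hg₁ hg₂
    (a := a₂ * a * a₁⁻¹) (l := -(a₂ * a * (a₁⁻¹ : Circle) * l₁) + a₂ * l + l₂)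
    (mul_mem (mul_mem d₂.mem_sixth ha) (inv_mem d₁.mem_sixth))
    (add_mem (add_mem (neg_mem (by
        rw [← Circle.coe_mul, ← Circle.coe_mul]
        exact sixth_mul_mem_lattice (mul_mem (mul_mem d₂.mem_sixth ha) (inv_mem d₁.mem_sixth))
          d₁.mem_lattice))
      (sixth_mul_mem_lattice d₂.mem_sixth hl)) d₂.mem_lattice)
    (by
      rw [d₁.dev_smul, d₂.dev_smul, h]
      push_cast
      field_simp
      ring)
  refine ⟨g₂⁻¹ * (γ * g₁), ?_, ?_⟩
  · convert d₂.inv.mul (d.mul d₁) using 1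
    · rw [inv_mul_cancel_right, inv_mul_cancel_left]
    · push_cast
      field_simp
      ring
  · rw [mul_smul, mul_smul, hγ, inv_smul_smul]

/-- Every motion of the tiling is developed from a modular transformation. -/
lemma exists_develops_motion {a : Circle} (ha : a ∈ sixth) {l : ℂ} (hl : l ∈ lattice) :
    ∃ γ, Develops γ a l := by
  have htrans : ∃ γ, Develops γ 1 l := by
    induction hl using AddSubgroup.closure_induction with
    | mem x hx =>
      -- Since `T ^ 3` and `S` develop into the half-turns about `0` and `1 / 2`, their product
      -- develops into the translation by `1`. Conjugating by `T` rotates it to the translation by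
      -- `zeta`.
      have h1 : Develops (ModularGroup.S * (ModularGroup.T * (ModularGroup.T * ModularGroup.T)))
          1 1 := by
        convert develops_S.mul (develops_T.mul (develops_T.mul develops_T)) using 1
        · rw [← zeta_pow_six]; group
        · simp
      rcases hx with rfl | rfl
      · exact ⟨_, h1⟩
      · rw [← coe_zeta]
        refine ⟨ModularGroup.T * (ModularGroup.S * (ModularGroup.T * (ModularGroup.T *
          ModularGroup.T)) * ModularGroup.T⁻¹), ?_⟩
        convert develops_T.mul (h1.mul develops_T_inv) using 1
        · simp
        · simp
    | zero => exact ⟨_, develops_one⟩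
    | add x y _ _ hx hy =>
      obtain ⟨γ, hγ⟩ := hx
      obtain ⟨δ, hδ⟩ := hy
      exact ⟨_, by simpa [add_comm] using hγ.mul hδ⟩
    | neg x _ hx =>
      obtain ⟨γ, hγ⟩ := hx
      exact ⟨_, by simpa using hγ.inv⟩
  have hrot : ∃ γ, Develops γ a 0 := by
    obtain ⟨k, -, rfl⟩ := exists_pow_of_mem_sixth ha
    clear ha
    induction k with
    | zero => exact ⟨1, by simpa using develops_one⟩
    | succ k ih =>
      obtain ⟨γ, hγ⟩ := ih
      exact ⟨_, by simpa [pow_succ] using hγ.mul develops_T⟩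
  obtain ⟨γ, hγ⟩ := htrans
  obtain ⟨δ, hδ⟩ := hrot
  exact ⟨_, by simpa using hγ.mul hδ⟩

/-! ### Topological properties of the developing map -/

/-- The derivative is a nonzero multiple of `η ^ 4`, and eta has no zeros, so `dev` is a local
homeomorphism. -/
lemma isOpenMap_dev : IsOpenMap fun τ : ℍ => dev τ := by
  refine IsOpenMap.of_nhds_le fun τ => ?_
  have hd : DifferentiableOn ℂ dev {τ : ℂ | 0 < τ.im} := fun z hz =>
    (hasDerivAt_dev hz).differentiableAt.differentiableWithinAt
  have hτ : {τ : ℂ | 0 < τ.im} ∈ nhds (τ : ℂ) :=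
    (isOpen_lt continuous_const continuous_im).mem_nhds τ.im_pos
  have hs := (hd.analyticAt hτ).hasStrictDerivAt
  rw [(hasDerivAt_dev τ.im_pos).deriv] at hs
  have h0 : devFactor * ModularForm.eta τ ^ 4 ≠ 0 :=
    mul_ne_zero devFactor_ne_zero (pow_ne_zero 4 (ModularForm.eta_ne_zero τ.im_pos))
  rw [← hs.map_nhds_eq h0, ← UpperHalfPlane.isOpenEmbedding_coe.map_nhds_eq, Filter.map_map]
  rfl

lemma continuous_dev : Continuous fun τ : ℍ => dev τ := by
  refine continuous_iff_continuousAt.mpr fun τ => ?_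
  exact (hasDerivAt_dev τ.im_pos).continuousAt.comp UpperHalfPlane.continuous_coe.continuousAt

lemma dev_notMem_lattice (τ : ℍ) : dev τ ∉ lattice := by
  obtain ⟨g, hg⟩ := ModularGroup.exists_smul_mem_fd τ
  obtain ⟨a, l, d⟩ := exists_develops g
  have h := notMem_lattice_of_mem_kite (dev_mem_kite hg)
  rw [d.dev_smul] at h
  exact fun h' => h (add_mem (sixth_mul_mem_lattice d.mem_sixth h') d.mem_lattice)

lemma norm_dev_le {τ : ℂ} (hτ : τ ∈ strip) :
    ‖dev τ‖ ≤ 3 / 2 * scale * Real.exp (-(Real.pi / 3 * τ.im)) := by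
  have h := norm_prim_sub_sub_le (s := 0) (by norm_num) (norm_cuspCoord_le_of_mem_strip hτ)
  rw [prim_zero, sub_zero, sub_zero] at h
  have h2 := norm_le_norm_sub_add (prim (cuspCoord τ)) (cuspCoord τ)
  have hs := scale_pos
  rw [dev, norm_mul, norm_real, Real.norm_eq_abs, abs_of_pos hs, ← norm_cuspCoord]
  nlinarith

lemma exists_norm_dev_lt {δ : ℝ} (hδ : 0 < δ) :
    ∃ r, ∀ τ ∈ strip, r < τ.im → ‖dev τ‖ < δ := by
  have ht : Filter.Tendsto (fun y : ℝ => 3 / 2 * scale * Real.exp (-(Real.pi / 3 * y)))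
      Filter.atTop (nhds (3 / 2 * scale * 0)) := by
    refine Filter.Tendsto.const_mul _ (Real.tendsto_exp_neg_atTop_nhds_zero.comp ?_)
    exact Filter.tendsto_id.const_mul_atTop (by positivity)
  rw [mul_zero] at ht
  obtain ⟨r, hr⟩ := Filter.eventually_atTop.mp (ht.eventually_lt_const hδ)
  exact ⟨r, fun τ hτ h => (norm_dev_le hτ).trans_lt (hr _ h.le)⟩

lemma norm_le_one_of_mem_kite {w : ℂ} (hw : w ∈ kite) : ‖w‖ ≤ 1 := by
  have h := three_mul_im_sq_le hw
  obtain ⟨h1, h2, -, -⟩ := hw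
  have : ‖w‖ ^ 2 ≤ 1 ^ 2 := by
    rw [← normSq_eq_norm_sq, normSq_apply]; nlinarith
  exact (pow_le_pow_iff_left₀ (norm_nonneg _) zero_le_one two_ne_zero).mp this

/-- High points of the fundamental domain have values near `0`, hence their translates have values
near the lattice and far from `z`. So the values near `z` come from the truncated, compact
fundamental domain by finitely many rotations and a bounded set of translations, and lie in a
compact part `K` of the range. -/
lemma mem_range_dev_of_mem_closure {z : ℂ} (hz : z ∉ lattice)
    (h : z ∈ closure (Set.range fun τ : ℍ => dev τ)) : z ∈ Set.range fun τ : ℍ => dev τ := by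
  obtain ⟨δ, hδ, hball⟩ := Metric.isOpen_iff.mp isClosed_lattice.isOpen_compl z hz
  obtain ⟨r, hr⟩ := exists_norm_dev_lt (half_pos hδ)
  set C : Set ℂ := (fun τ : ℍ => dev τ) '' ModularGroup.truncatedFundamentalDomain r
  have hC : IsCompact C :=
    (ModularGroup.isCompact_truncatedFundamentalDomain r).image continuous_dev
  -- The summand `1` bounds the norm on the kite, and `δ` bounds the distance to `z`.
  set L : Set ℂ := lattice ∩ Metric.closedBall 0 (‖z‖ + δ + 1)
  have hL : IsCompact L := (isCompact_closedBall 0 _).inter_left isClosed_lattice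
  have hA : IsCompact (sixth : Set Circle) := (Set.finite_coe_iff.mp (inferInstanceAs (Finite sixth))).isCompact
  set K : Set ℂ := (fun x : Circle × ℂ × ℂ => (x.1 : ℂ) * x.2.1 + x.2.2) ''
    ((sixth : Set Circle) ×ˢ C ×ˢ L)
  have hK : IsCompact K := (hA.prod (hC.prod hL)).image (by fun_prop)
  have hKr : K ⊆ Set.range fun τ : ℍ => dev τ := by
    rintro _ ⟨⟨a, w, l⟩, ⟨ha, ⟨τ, -, rfl⟩, hl⟩, rfl⟩
    obtain ⟨γ, d⟩ := exists_develops_motion ha hl.1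
    exact ⟨γ • τ, d.dev_smul τ⟩
  have hsub : (Set.range fun τ : ℍ => dev τ) ∩ Metric.ball z (δ / 2) ⊆ K := by
    rintro _ ⟨⟨τ, rfl⟩, hτ⟩
    obtain ⟨g, hg⟩ := ModularGroup.exists_smul_mem_fd τ
    obtain ⟨a, l, d⟩ := exists_develops g
    have hd : dev τ = (a⁻¹ : Circle) * dev (g • τ : ℍ) + -((a⁻¹ : Circle) * l) := by
      rw [d.dev_smul, Circle.coe_inv]
      field_simp
      ring
    set l' : ℂ := -((a⁻¹ : Circle) * l)
    have hl' : l' ∈ lattice :=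
      neg_mem (sixth_mul_mem_lattice (inv_mem d.mem_sixth) d.mem_lattice)
    have hnorm : ‖dev τ - l'‖ = ‖dev (g • τ : ℍ)‖ := by
      rw [hd, add_sub_cancel_right, norm_mul, Circle.norm_coe, one_mul]
    rw [Metric.mem_ball, dist_eq] at hτ
    refine ⟨(a⁻¹, dev (g • τ : ℍ), l'), ⟨inv_mem d.mem_sixth, ⟨g • τ, ⟨hg, ?_⟩, rfl⟩, hl', ?_⟩,
      hd.symm⟩
    · by_contra him
      have h1 := hr _ (mem_strip_of_mem_fd hg) (not_le.mp him)
      rw [← hnorm] at h1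
      refine hball (a := l') ?_ hl'
      rw [Metric.mem_ball, dist_eq, ← norm_neg]
      calc ‖-(l' - z)‖ = ‖(dev τ - l') - (dev τ - z)‖ := by congr 1; ring
        _ ≤ ‖dev τ - l'‖ + ‖dev τ - z‖ := norm_sub_le _ _
        _ < δ := by linarith
    · rw [mem_closedBall_zero_iff]
      have h1 := norm_le_one_of_mem_kite (dev_mem_kite hg)
      rw [← hnorm] at h1
      calc ‖l'‖ = ‖z + (dev τ - z) - (dev τ - l')‖ := by congr 1; ring
        _ ≤ ‖z + (dev τ - z)‖ + ‖dev τ - l'‖ := norm_sub_le _ _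
        _ ≤ ‖z‖ + ‖dev τ - z‖ + ‖dev τ - l'‖ := by gcongr; exact norm_add_le _ _
        _ ≤ ‖z‖ + δ + 1 := by linarith
  have hz' : z ∈ closure ((Set.range fun τ : ℍ => dev τ) ∩ Metric.ball z (δ / 2)) :=
    Set.inter_comm _ _ ▸
      Metric.isOpen_ball.inter_closure ⟨Metric.mem_ball_self (half_pos hδ), h⟩
  exact hKr (hK.isClosed.closure_subset_iff.mpr hsub hz')

lemma isPreconnected_compl_lattice : IsPreconnected ((lattice : Set ℂ)ᶜ) := by
  have hc : (lattice : Set ℂ).Countable := Set.countable_coe_iff.mp (inferInstanceAs (Countable lattice))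
  exact (hc.isConnected_compl_of_one_lt_rank (by
    rw [Complex.rank_real_complex]; exact Nat.one_lt_ofNat)).isPreconnected

/-- The image of the developing map is the complement of the lattice. -/
theorem exists_dev_eq {z : ℂ} (hz : z ∉ lattice) : ∃ τ : ℍ, dev τ = z := by
  -- The range is open and relatively closed in the complement of the lattice, which is connected
  -- because the lattice is countable.
  have h := isPreconnected_compl_lattice.subset_of_closure_inter_subset
    (u := Set.range fun τ : ℍ => dev τ) isOpenMap_dev.isOpen_range
    ⟨dev UpperHalfPlane.I, dev_notMem_lattice _, ⟨_, rfl⟩⟩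
    fun w hw => mem_range_dev_of_mem_closure hw.2 hw.1
  exact h hz

open MulAction Topology

/-! ### Quotient maps that are equivariant along a homomorphism -/

/-- A continuous open surjection `π : X → M`, equivariant along `χ : G →* A`, such that points of
`X` whose images are equivalent under `a : A` are equivalent under an element of `G` above `a`. -/
structure IsEquivariantCover {G X A M : Type*} [Group G] [MulAction G X] [TopologicalSpace X]
    [Group A] [MulAction A M] [TopologicalSpace M] (χ : G →* A) (π : X → M) : Prop where
  continuous : Continuous π
  isOpenMap : IsOpenMap π
  surjective : Function.Surjective π
  map_smul : ∀ g x, π (g • x) = χ g • π x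
  exists_smul_eq : ∀ x y a, π y = a • π x → ∃ g, χ g = a ∧ g • x = y

namespace IsEquivariantCover

variable {G X : Type*} {A M : Type*} [Group G] [MulAction G X] [TopologicalSpace X]
  [Group A] [MulAction A M] [TopologicalSpace M] {χ : G →* A} {π : X → M}
  (hπ : IsEquivariantCover χ π)

/-- The map `M → X / G` that takes the image of `x : X` to the class of `x`. -/
noncomputable def descend (m : M) : Quotient (orbitRel G X) :=
  Quotient.mk _ (Function.surjInv hπ.surjective m)

lemma descend_apply (x : X) : hπ.descend (π x) = Quotient.mk (orbitRel G X) x := by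
  obtain ⟨g, -, hg⟩ := hπ.exists_smul_eq x (Function.surjInv hπ.surjective (π x)) 1
    (by rw [one_smul, Function.surjInv_eq hπ.surjective])
  exact Quotient.sound ⟨g, hg⟩

lemma descend_eq_iff {m n : M} : hπ.descend m = hπ.descend n ↔ m ∈ orbit A n := by
  obtain ⟨x, rfl⟩ := hπ.surjective m
  obtain ⟨y, rfl⟩ := hπ.surjective n
  rw [hπ.descend_apply, hπ.descend_apply, Quotient.eq]
  constructor
  · rintro ⟨g, rfl⟩
    exact ⟨χ g, (hπ.map_smul g y).symm⟩
  · rintro ⟨a, ha⟩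
    obtain ⟨g, -, hg⟩ := hπ.exists_smul_eq y x a ha.symm
    exact ⟨g, hg⟩

lemma descend_eq_mk_iff {m : M} {x : X} :
    hπ.descend m = Quotient.mk (orbitRel G X) x ↔ m ∈ orbit A (π x) := by
  rw [← hπ.descend_apply, hπ.descend_eq_iff]

lemma isQuotientMap_descend : IsQuotientMap hπ.descend := by
  have hcomp : hπ.descend ∘ π = Quotient.mk (orbitRel G X) := funext hπ.descend_apply
  have hmk : IsQuotientMap (hπ.descend ∘ π) := hcomp ▸ isQuotientMap_quot_mk
  have hq : IsQuotientMap π := hπ.isOpenMap.isQuotientMap hπ.continuous hπ.surjective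
  exact .of_comp hπ.continuous (hq.continuous_iff.mpr hmk.continuous) hmk

/-- The map `descend` is the quotient by a free action of a finite group on a locally compact
Hausdorff space; its fibres are torsors. -/
lemma isCoverOfDegree_descend [Finite A] [ContinuousConstSMul A M] [IsCancelSMul A M]
    [T2Space M] [LocallyCompactSpace M] : IsCoverOfDegree (Nat.card A) hπ.descend := by
  have h : IsQuotientCoveringMap hπ.descend A :=
    hπ.isQuotientMap_descend.isQuotientCoveringMap_of_properlyDiscontinuousSMul
      hπ.descend_eq_iff
  refine ⟨h.isCoveringMap, fun b => ?_⟩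
  obtain ⟨m, hm⟩ := h.surjective b
  exact Nat.card_congr (h.fiberEquivGroup ⟨m, hm⟩)

/-- The elements of the stabilizer of `π x` are the images of the stabilizer of `x`. -/
lemma stabilizer_apply (hπ : IsEquivariantCover χ π) (x : X) : stabilizer A (π x) = (stabilizer G x).map χ := by
  ext a
  constructor
  · intro ha
    obtain ⟨g, hg, hx⟩ := hπ.exists_smul_eq x x a (mem_stabilizer_iff.mp ha).symm
    exact ⟨g, hx, hg⟩
  · rintro ⟨g, hg, rfl⟩
    rw [mem_stabilizer_iff, ← hπ.map_smul, mem_stabilizer_iff.mp hg]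

/-- Since `χ` is injective on stabilizers, those of `x` and `π x` have the same order. The fibre is
the orbit of `π x`, so orbit-stabilizer applies. -/
lemma card_fiber_mul_card_stabilizer
    (hχ : ∀ (x : X) (g : G), g • x = x → χ g = 1 → g = 1) (x : X) :
    Nat.card (hπ.descend ⁻¹' {Quotient.mk (orbitRel G X) x}) * Nat.card (stabilizer G x) =
      Nat.card A := by
  have hfib : hπ.descend ⁻¹' {Quotient.mk (orbitRel G X) x} = orbit A (π x) := by
    ext m
    exact hπ.descend_eq_mk_iff
  have hst : Nat.card (stabilizer G x) = Nat.card (stabilizer A (π x)) := by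
    rw [hπ.stabilizer_apply]
    refine Nat.card_congr (Equiv.ofBijective
      (fun g : stabilizer G x => (⟨χ g, g, g.2, rfl⟩ : (stabilizer G x).map χ)) ⟨?_, ?_⟩)
    · intro g h hgh
      have h1 : χ ((g : G) * (h : G)⁻¹) = 1 := by
        rw [map_mul, map_inv, mul_inv_eq_one]
        exact congrArg Subtype.val hgh
      exact Subtype.ext (mul_inv_eq_one.mp (hχ x _ (g * h⁻¹).2 h1))
    · rintro ⟨_, g, hg, rfl⟩
      exact ⟨⟨g, hg⟩, rfl⟩
  rw [hfib, hst, ← Nat.card_prod, Nat.card_congr (orbitProdStabilizerEquivGroup A (π x))]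

/-- The descended map is an orbifold covering if the action on `X` is properly discontinuous and
`χ` is injective on stabilizers. -/
lemma isOrbifoldCover_descend.{u, v, w} {G : Type u} {X : Type v} {A M : Type w} [Group G]
    [MulAction G X] [TopologicalSpace X] [Group A] [MulAction A M] [TopologicalSpace M]
    {χ : G →* A} {π : X → M} (hπ : IsEquivariantCover χ π) [ContinuousConstSMul A M]
    (hχ : ∀ (x : X) (g : G), g • x = x → χ g = 1 → g = 1)
    (hU : ∀ x : X, ∃ U : Set X, IsOpen U ∧ x ∈ U ∧
      (∀ g ∈ stabilizer G x, ∀ y ∈ U, g • y ∈ U) ∧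
      ∀ g ∉ stabilizer G x, ∀ y ∈ U, g • y ∉ U) : IsOrbifoldCover hπ.descend := by
  refine ⟨hπ.isQuotientMap_descend.continuous, fun x => ?_⟩
  obtain ⟨U, hUo, hxU, hst, hdisj⟩ := hU x
  let _ : TopologicalSpace (A ⧸ (stabilizer G x).map χ) := ⊥
  have hd : DiscreteTopology (A ⧸ (stabilizer G x).map χ) := ⟨rfl⟩
  refine ⟨U, hUo, hxU, hst, hdisj, A ⧸ (stabilizer G x).map χ, _, hd, ?_⟩
  -- There is one sheet per coset of the stabilizer of `π x`; each is the image of `U` translated by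
  -- a representative of the coset.
  let f : U × (A ⧸ (stabilizer G x).map χ) → M := fun u => u.2.out • π u.1
  have hcont : Continuous f := continuous_prod_of_discrete_right.mpr fun i =>
    (hπ.continuous.comp continuous_subtype_val).const_smul i.out
  have hopen : IsOpenMap f := isOpenMap_prod_of_discrete_right.mpr fun i =>
    (isOpenMap_smul i.out).comp (hπ.isOpenMap.comp hUo.isOpenMap_subtype_val)
  have hinj : Function.Injective f := by
    rintro ⟨u, i⟩ ⟨v, j⟩ huv
    have h1 : π u = (i.out⁻¹ * j.out) • π v := by
      rw [mul_smul, eq_inv_smul_iff]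
      exact huv
    obtain ⟨g, hg, hgv⟩ := hπ.exists_smul_eq _ _ _ h1
    have hgs : g ∈ stabilizer G x := by
      by_contra hgs
      exact hdisj g hgs v v.2 (hgv ▸ u.2)
    have hij : i = j := by
      rw [← i.out_eq', ← j.out_eq']
      exact QuotientGroup.eq.mpr ⟨g, hgs, hg⟩
    subst hij
    rw [inv_mul_cancel] at hg
    have hg1 := hχ x g hgs hg
    rw [hg1, one_smul] at hgv
    exact Prod.ext (Subtype.ext hgv.symm) rfl
  have hrange : Set.range f = hπ.descend ⁻¹' (Quotient.mk (orbitRel G X) '' U) := by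
    ext m
    constructor
    · rintro ⟨⟨u, i⟩, rfl⟩
      exact ⟨u, u.2, (hπ.descend_eq_mk_iff.mpr ⟨i.out, rfl⟩).symm⟩
    · rintro ⟨u, hu, hm⟩
      obtain ⟨a, rfl⟩ := hπ.descend_eq_mk_iff.mp hm.symm
      obtain ⟨h, hh⟩ := QuotientGroup.mk_out_eq_mul ((stabilizer G x).map χ) a
      obtain ⟨g, hg, hgh⟩ := h.2
      refine ⟨(⟨g⁻¹ • u, hst _ (inv_mem hg) u hu⟩, (a : A ⧸ (stabilizer G x).map χ)), ?_⟩
      change (a : A ⧸ (stabilizer G x).map χ).out • π (g⁻¹ • u) = a • π u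
      rw [hh, hπ.map_smul, ← hgh, map_inv, mul_smul, smul_inv_smul]
  have hemb : IsOpenEmbedding f := .of_continuous_injective_isOpenMap hcont hinj hopen
  exact ⟨hemb.isEmbedding.toHomeomorph.trans (Homeomorph.setCongr hrange),
    fun u => hπ.descend_eq_mk_iff.mpr ⟨u.2.out, rfl⟩⟩

end IsEquivariantCover

/-! ### Covering transformations -/

/-- The action of a group by homeomorphisms, as a homomorphism. -/
def smulHom (A M : Type*) [Group A] [MulAction A M] [TopologicalSpace M]
    [ContinuousConstSMul A M] : A →* (M ≃ₜ M) where
  toFun := Homeomorph.smul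
  map_one' := Homeomorph.ext fun m => one_smul A m
  map_mul' a b := Homeomorph.ext fun m => mul_smul a b m

lemma smulHom_apply {A M : Type*} [Group A] [MulAction A M] [TopologicalSpace M]
    [ContinuousConstSMul A M] (a : A) (m : M) : smulHom A M a m = a • m := rfl

/-- A continuous map that preserves the orbits of a finite group, which acts freely on a dense
connected set, agrees with an element of the group. -/
lemma exists_eq_smul_of_mem_orbit {A M : Type*} [Group A] [Finite A] [MulAction A M]
    [TopologicalSpace M] [ContinuousConstSMul A M] [T2Space M] {D : Set M} (hD : IsConnected D)
    (hdense : Dense D) (hfree : ∀ m ∈ D, ∀ a : A, a • m = m → a = 1) {f : M → M}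
    (hf : Continuous f) (horb : ∀ m, f m ∈ orbit A m) : ∃ a : A, ∀ m, f m = a • m := by
  obtain ⟨m₀, hm₀⟩ := hD.nonempty
  obtain ⟨a, ha⟩ := horb m₀
  refine ⟨a, ?_⟩
  have hclosed (b : A) : IsClosed {m | f m = b • m} :=
    isClosed_eq hf (continuous_const_smul b)
  have hsub : D ⊆ {m | f m = a • m} := by
    by_contra hne
    obtain ⟨m₁, hm₁, hne⟩ := Set.not_subset.mp hne
    obtain ⟨b, hb⟩ := horb m₁
    have hba : b ≠ a := by
      rintro rfl
      exact hne hb.symm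
    -- The agreement set of `a` and the union of the finitely many others are closed and cover `D`.
    -- A common point in `D` would contradict freeness.
    obtain ⟨m, hmD, hma, hmb⟩ := isPreconnected_closed_iff.mp hD.isPreconnected
      {m | f m = a • m} (⋃ b ∈ {b : A | b ≠ a}, {m | f m = b • m}) (hclosed a)
      ((Set.toFinite _).isClosed_biUnion fun b _ => hclosed b)
      (fun m _ => by
        obtain ⟨b, hb⟩ := horb m
        by_cases h : b = a
        · exact Or.inl (h ▸ hb.symm)
        · exact Or.inr (Set.mem_biUnion h hb.symm))
      ⟨m₀, hm₀, ha.symm⟩ ⟨m₁, hm₁, Set.mem_biUnion hba hb.symm⟩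
    obtain ⟨c, hca, hc⟩ := Set.mem_iUnion₂.mp hmb
    refine hca (inv_mul_eq_one.mp (hfree m hmD (a⁻¹ * c) ?_)).symm
    rw [mul_smul, inv_smul_eq_iff]
    exact hc.symm.trans hma
  intro m
  exact (hclosed a).closure_subset_iff.mpr hsub (hdense m)

/-- The fibres are the orbits of `A`, so a covering transformation preserves orbits. The subset `D`
is needed because `sixth` fixes points of the punctured torus, such as the class of an edge centre
under the half-turn. -/
lemma IsEquivariantCover.deckGroup_descend {G X A M : Type*} [Group G] [MulAction G X]
    [TopologicalSpace X] [Group A] [Finite A] [MulAction A M] [TopologicalSpace M] [T2Space M]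
    [ContinuousConstSMul A M] {χ : G →* A} {π : X → M} (hπ : IsEquivariantCover χ π) {D : Set M}
    (hD : IsConnected D) (hdense : Dense D) (hfree : ∀ m ∈ D, ∀ a : A, a • m = m → a = 1) :
    deckGroup hπ.descend = (smulHom A M).range := by
  ext f
  constructor
  · intro hf
    obtain ⟨a, ha⟩ := exists_eq_smul_of_mem_orbit hD hdense hfree f.continuous
      fun m => hπ.descend_eq_iff.mp (hf m)
    exact ⟨a, Homeomorph.ext fun m => (ha m).symm⟩
  · rintro ⟨a, rfl⟩ m
    exact hπ.descend_eq_iff.mpr ⟨a, rfl⟩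

lemma smulHom_injective {A M : Type*} [Group A] [MulAction A M] [TopologicalSpace M]
    [ContinuousConstSMul A M] {m : M} (hm : ∀ a : A, a • m = m → a = 1) :
    Function.Injective (smulHom A M) := by
  refine (injective_iff_map_eq_one _).mpr fun a ha => hm a ?_
  rw [← smulHom_apply, ha]
  rfl

/-! ### The action of the sixth roots of unity on the punctured torus -/

noncomputable instance : MulAction sixth PuncturedPlane where
  smul a z := ⟨(a : Circle) * z.1, fun h => z.2 ((sixth_mul_mem_lattice_iff a.2).mp h)⟩
  one_smul z := Subtype.ext (by
    change ((1 : Circle) : ℂ) * z.1 = z.1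
    rw [Circle.coe_one, one_mul])
  mul_smul a b z := Subtype.ext (by
    change (((a : Circle) * b : Circle) : ℂ) * z.1 = (a : Circle) * ((b : Circle) * z.1)
    rw [Circle.coe_mul, mul_assoc])

lemma coe_smul_puncturedPlane (a : sixth) (z : PuncturedPlane) :
    (a • z).1 = (a : Circle) * z.1 := rfl

lemma coe_vadd_puncturedPlane (l : lattice) (z : PuncturedPlane) : (l +ᵥ z).1 = l + z.1 := rfl

instance : ContinuousConstSMul sixth PuncturedPlane where
  continuous_const_smul _ :=
    (continuous_const.mul continuous_subtype_val).subtype_mk _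

instance : ContinuousConstVAdd lattice PuncturedPlane where
  continuous_const_vadd _ :=
    (continuous_const.add continuous_subtype_val).subtype_mk _

instance : ContinuousConstVAdd lattice UTPuncturedPlane where
  continuous_const_vadd l :=
    ((continuous_const_vadd l).comp continuous_fst).prodMk continuous_snd

/-- Multiplication by a sixth root of unity normalises the translations by the lattice. -/
lemma smul_vadd_puncturedPlane (a : sixth) (l : lattice) (z : PuncturedPlane) :
    a • (l +ᵥ z) = (⟨(a : Circle) * l, sixth_mul_mem_lattice a.2 l.2⟩ : lattice) +ᵥ a • z :=
  Subtype.ext (mul_add _ _ _)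

noncomputable instance : MulAction sixth PuncturedTorus where
  smul a := Quotient.map (a • ·) (by
    rintro _ z ⟨l, rfl⟩
    exact ⟨_, (smul_vadd_puncturedPlane a l z).symm⟩)
  one_smul t := by
    induction t using Quotient.inductionOn with
    | h z => exact congrArg (Quotient.mk _) (one_smul sixth z)
  mul_smul a b t := by
    induction t using Quotient.inductionOn with
    | h z => exact congrArg (Quotient.mk _) (mul_smul a b z)

noncomputable instance : MulAction sixth UTPuncturedTorus where
  smul a := Quotient.map (a • ·) (by
    rintro _ ⟨z, v⟩ ⟨l, rfl⟩
    exact ⟨_, Prod.ext (smul_vadd_puncturedPlane a l z).symm rfl⟩)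
  one_smul t := by
    induction t using Quotient.inductionOn with
    | h z => exact congrArg (Quotient.mk _) (one_smul sixth z)
  mul_smul a b t := by
    induction t using Quotient.inductionOn with
    | h z => exact congrArg (Quotient.mk _) (mul_smul a b z)

lemma smul_toTorus (a : sixth) (z : PuncturedPlane) : a • toTorus z = toTorus (a • z) := rfl

lemma smul_toUTTorus (a : sixth) (z : PuncturedPlane) (v : Circle) :
    a • toUTTorus z v = toUTTorus (a • z) (a * v) := rfl

instance : ContinuousConstSMul sixth PuncturedTorus where
  continuous_const_smul a := isQuotientMap_quot_mk.continuous_iff.mpr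
    (continuous_quot_mk.comp (continuous_const_smul (T := PuncturedPlane) a))

instance : ContinuousConstSMul sixth UTPuncturedTorus where
  continuous_const_smul a := isQuotientMap_quot_mk.continuous_iff.mpr
    (continuous_quot_mk.comp (continuous_const_smul (T := UTPuncturedPlane) a))

/-! ### Topology of the punctured torus and of its unit tangent bundle. -/

lemma toTorus_eq_iff {z w : PuncturedPlane} : toTorus z = toTorus w ↔ z.1 - w.1 ∈ lattice := by
  rw [toTorus, toTorus, Quotient.eq]
  constructor
  · rintro ⟨l, rfl⟩
    change (l : ℂ) + w.1 - w.1 ∈ lattice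
    rw [add_sub_cancel_right]
    exact l.2
  · intro h
    exact ⟨⟨_, h⟩, Subtype.ext (sub_add_cancel _ _)⟩

lemma toUTTorus_eq_iff {z w : PuncturedPlane} {u v : Circle} :
    toUTTorus z u = toUTTorus w v ↔ z.1 - w.1 ∈ lattice ∧ u = v := by
  rw [toUTTorus, toUTTorus, Quotient.eq]
  constructor
  · rintro ⟨l, hl⟩
    obtain ⟨rfl, rfl⟩ := Prod.ext_iff.mp hl
    change (l : ℂ) + w.1 - w.1 ∈ lattice ∧ _
    rw [add_sub_cancel_right]
    exact ⟨l.2, rfl⟩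
  · rintro ⟨h, rfl⟩
    exact ⟨⟨_, h⟩, Prod.ext (Subtype.ext (sub_add_cancel _ _)) rfl⟩

lemma continuous_toTorus : Continuous toTorus := continuous_quot_mk

lemma isOpenMap_toTorus : IsOpenMap toTorus :=
  isOpenMap_quotient_mk'_add

lemma surjective_toTorus : Function.Surjective toTorus := Quotient.mk_surjective

lemma continuous_toUTTorus : Continuous fun q : UTPuncturedPlane => toUTTorus q.1 q.2 :=
  continuous_quot_mk

lemma isOpenMap_toUTTorus : IsOpenMap fun q : UTPuncturedPlane => toUTTorus q.1 q.2 :=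
  isOpenMap_quotient_mk'_add

lemma surjective_toUTTorus :
    Function.Surjective fun q : UTPuncturedPlane => toUTTorus q.1 q.2 := Quotient.mk_surjective

/-- The inclusion of the punctured torus into the torus. -/
def torusIncl : PuncturedTorus → ℂ ⧸ lattice :=
  Quotient.lift (fun z => (z.1 : ℂ ⧸ lattice)) (by
    intro z w h
    rw [QuotientAddGroup.eq, ← neg_mem_iff, neg_add, neg_neg, ← sub_eq_add_neg]
    exact toTorus_eq_iff.mp (Quotient.sound h))

lemma continuous_torusIncl : Continuous torusIncl :=
  (QuotientAddGroup.continuous_mk.comp continuous_subtype_val).quotient_lift _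

lemma injective_torusIncl : Function.Injective torusIncl := by
  intro s t h
  obtain ⟨z, rfl⟩ := surjective_toTorus s
  obtain ⟨w, rfl⟩ := surjective_toTorus t
  refine toTorus_eq_iff.mpr ?_
  have := QuotientAddGroup.eq.mp h
  rwa [← neg_mem_iff, neg_add, neg_neg, ← sub_eq_add_neg] at this

instance : T2Space (ℂ ⧸ lattice) := by
  have : IsClosed (lattice : Set ℂ) := isClosed_lattice
  infer_instance

instance : T2Space PuncturedTorus :=
  .of_injective_continuous injective_torusIncl continuous_torusIncl

/-- A unit tangent vector of the punctured torus as a point of a product. -/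
def utTorusIncl : UTPuncturedTorus → PuncturedTorus × Circle :=
  Quotient.lift (fun q => (toTorus q.1, q.2)) (by
    intro q r h
    have := toUTTorus_eq_iff.mp (Quotient.sound h : toUTTorus q.1 q.2 = toUTTorus r.1 r.2)
    exact Prod.ext (toTorus_eq_iff.mpr this.1) this.2)

lemma continuous_utTorusIncl : Continuous utTorusIncl :=
  ((continuous_toTorus.comp continuous_fst).prodMk continuous_snd).quotient_lift _

lemma injective_utTorusIncl : Function.Injective utTorusIncl := by
  intro s t h
  obtain ⟨q, rfl⟩ := surjective_toUTTorus s
  obtain ⟨r, rfl⟩ := surjective_toUTTorus t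
  obtain ⟨h1, h2⟩ := Prod.ext_iff.mp h
  exact toUTTorus_eq_iff.mpr ⟨toTorus_eq_iff.mp h1, h2⟩

instance : T2Space UTPuncturedTorus :=
  .of_injective_continuous injective_utTorusIncl continuous_utTorusIncl

instance : LocallyCompactSpace PuncturedPlane :=
  isClosed_lattice.isOpen_compl.isOpenEmbedding_subtypeVal.locallyCompactSpace

instance : LocallyCompactSpace UTPuncturedTorus :=
  IsOpenQuotientMap.locallyCompactSpace
    ⟨surjective_toUTTorus, continuous_toUTTorus, isOpenMap_toUTTorus⟩

/-- The direction is multiplied by `a`, and translations do not change directions, so only `a = 1`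
has fixed points. -/
instance : IsCancelSMul sixth UTPuncturedTorus :=
  isCancelSMul_iff_eq_one_of_smul_eq.mpr fun a t h => by
    obtain ⟨⟨z, v⟩, rfl⟩ := surjective_toUTTorus t
    have h2 := (toUTTorus_eq_iff.mp h).2
    exact Subtype.ext (mul_eq_right.mp h2)

instance : ConnectedSpace PuncturedPlane := by
  have hc : (lattice : Set ℂ).Countable :=
    Set.countable_coe_iff.mp (inferInstanceAs (Countable lattice))
  have h : IsConnected ((lattice : Set ℂ)ᶜ) := hc.isConnected_compl_of_one_lt_rank (by
    rw [Complex.rank_real_complex]; exact Nat.one_lt_ofNat)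
  exact isConnected_iff_connectedSpace.mp h

lemma isConnected_univ_utPuncturedTorus : IsConnected (Set.univ : Set UTPuncturedTorus) := by
  have := isConnected_range continuous_toUTTorus
  rwa [surjective_toUTTorus.range_eq] at this

/-! ### The free part of the action on the punctured torus -/

/-- The points of the plane whose classes in the torus have nontrivial stabilizers, and the
vertices. -/
def singularPoints : Set ℂ :=
  ⋃ a ∈ {a : sixth | a ≠ 1}, {z | (((a : Circle) : ℂ) - 1) * z ∈ lattice}

lemma lattice_subset_singularPoints : (lattice : Set ℂ) ⊆ singularPoints := by
  intro z hz
  have h3 : zeta ^ 3 ≠ 1 := by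
    intro h
    have := orderOf_dvd_of_pow_eq_one h
    rw [orderOf_zeta] at this
    omega
  -- The element `-1` works for every lattice point, as `-2 z` is again in the lattice.
  refine Set.mem_biUnion (x := zetaGen ^ 3) (fun h => h3 (congrArg Subtype.val h)) ?_
  change (((zetaGen ^ 3 : sixth) : Circle) - 1 : ℂ) * z ∈ lattice
  have : (((zetaGen ^ 3 : sixth) : Circle) : ℂ) = -1 := by
    rw [← zeta_cube, ← Circle.coe_pow]; rfl
  rw [this, sub_mul, one_mul, neg_one_mul]
  exact sub_mem (neg_mem hz) hz

lemma countable_singularPoints : singularPoints.Countable := by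
  refine (Set.toFinite _).countable.biUnion fun a ha => ?_
  have h0 : ((a : Circle) : ℂ) - 1 ≠ 0 := by
    rw [sub_ne_zero]
    intro h
    exact ha (Subtype.ext (Circle.coe_injective h))
  exact Set.Countable.preimage_of_injOn (Set.countable_coe_iff.mp
    (inferInstanceAs (Countable lattice))) (mul_right_injective₀ h0).injOn

/-- The points of the punctured torus with trivial stabilizers. -/
def freeTorus : Set PuncturedTorus :=
  toTorus '' {z | z.1 ∉ singularPoints}

lemma eq_one_of_mem_freeTorus {t : PuncturedTorus} (ht : t ∈ freeTorus) {a : sixth}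
    (h : a • t = t) : a = 1 := by
  obtain ⟨z, hz, rfl⟩ := ht
  by_contra ha
  refine hz (Set.mem_biUnion (x := a) ha ?_)
  have := toTorus_eq_iff.mp h
  rw [coe_smul_puncturedPlane] at this
  rw [Set.mem_ofPred_eq, sub_mul, one_mul]
  exact this

lemma isEmbedding_coe_puncturedPlane : IsEmbedding (fun z : PuncturedPlane => z.1) :=
  IsEmbedding.subtypeVal

lemma isOpenEmbedding_coe_puncturedPlane : IsOpenEmbedding (fun z : PuncturedPlane => z.1) :=
  isClosed_lattice.isOpen_compl.isOpenEmbedding_subtypeVal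

/-- It is the image of the complement of a countable set in the plane. -/
lemma isConnected_freeTorus : IsConnected freeTorus := by
  have h : IsConnected (singularPointsᶜ) :=
    countable_singularPoints.isConnected_compl_of_one_lt_rank (by
      rw [Complex.rank_real_complex]; exact Nat.one_lt_ofNat)
  refine IsConnected.image ?_ toTorus continuous_toTorus.continuousOn
  have himage : (fun z : PuncturedPlane => z.1) '' {z | z.1 ∉ singularPoints} =
      singularPointsᶜ := by
    ext z
    constructor
    · rintro ⟨w, hw, rfl⟩
      exact hw
    · intro hz
      exact ⟨⟨z, fun h => hz (lattice_subset_singularPoints h)⟩, hz, rfl⟩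
  rw [← himage] at h
  exact ⟨h.nonempty.of_image, isEmbedding_coe_puncturedPlane.isInducing.isPreconnected_image.mp
    h.isPreconnected⟩

lemma dense_freeTorus : Dense freeTorus := by
  refine surjective_toTorus.denseRange.dense_image continuous_toTorus ?_
  exact (countable_singularPoints.dense_compl ℝ).preimage
    isOpenEmbedding_coe_puncturedPlane.isOpenMap

/-! ### The rotational part of the holonomy -/

/-- Neither eta nor the denominator vanishes, so the transformation law of `η ^ 4` at `i` determines
the rotational part. This makes `rotSL` a homomorphism. -/
lemma Develops.rotation_unique {γ : SL(2, ℤ)} {a b : Circle} {l m : ℂ} (ha : Develops γ a l)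
    (hb : Develops γ b m) : a = b := by
  have h := (ha.eta_smul UpperHalfPlane.I).symm.trans (hb.eta_smul UpperHalfPlane.I)
  have h1 : ModularForm.eta UpperHalfPlane.I ^ 4 ≠ 0 :=
    pow_ne_zero 4 (ModularForm.eta_ne_zero UpperHalfPlane.I.im_pos)
  have h2 := pow_ne_zero 2 (UpperHalfPlane.denom_ne_zero (γ : GL (Fin 2) ℝ) UpperHalfPlane.I)
  exact Circle.coe_injective (mul_right_cancel₀ h2 (mul_right_cancel₀ h1 h))

lemma develops_neg_one : Develops (-1) 1 0 where
  mem_sixth := one_mem _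
  mem_lattice := zero_mem _
  dev_smul τ := by rw [ModularGroup.SL_neg_smul, one_smul]; simp
  eta_smul τ := by
    rw [ModularGroup.SL_neg_smul, one_smul, ModularGroup.denom_apply]
    simp

/-- The rotational part of the motion developed from an element of `SL(2, ℤ)`. -/
noncomputable def rotSL : SL(2, ℤ) →* sixth :=
  MonoidHom.mk' (fun γ => ⟨(exists_develops γ).choose,
    (exists_develops γ).choose_spec.choose_spec.mem_sixth⟩) fun γ δ =>
    Subtype.ext ((exists_develops (γ * δ)).choose_spec.choose_spec.rotation_unique
      ((exists_develops γ).choose_spec.choose_spec.mul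
        (exists_develops δ).choose_spec.choose_spec))

lemma Develops.rotSL_eq {γ : SL(2, ℤ)} {a : Circle} {l : ℂ} (h : Develops γ a l) :
    (rotSL γ : Circle) = a :=
  (exists_develops γ).choose_spec.choose_spec.rotation_unique h

/-- The rotational part of the motion developed from a modular transformation. -/
noncomputable def rot : PSL(2, ℤ) →* sixth :=
  QuotientGroup.lift _ rotSL (by
    intro γ hγ
    rcases eq_one_or_neg_one_of_mem_center hγ with rfl | rfl
    · exact map_one _
    · exact Subtype.ext develops_neg_one.rotSL_eq)

lemma Develops.rot_eq {γ : SL(2, ℤ)} {a : Circle} {l : ℂ} (h : Develops γ a l) :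
    (rot (γ : PSL(2, ℤ)) : Circle) = a := h.rotSL_eq

/-- At a fixed point `x` with trivial rotational part, the law for `η ^ 4` reads `(c x + d) ^ 2 =
1`. As `x` is not real, `c = 0` and `d = ±1`, so the element is a translation fixing `x`. Thus `rot`
is injective on stabilizers, as the orbifold covering requires. -/
lemma eq_one_of_rot_eq_one (x : ℍ) (g : PSL(2, ℤ)) (hx : g • x = x) (hg : rot g = 1) :
    g = 1 := by
  induction g using QuotientGroup.induction_on with
  | H γ =>
    obtain ⟨a, l, h⟩ := exists_develops γ
    have ha : a = 1 := by rw [← h.rot_eq, hg]; rfl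
    rw [psl_smul_pt] at hx
    have heta := h.eta_smul x
    have h1 : ModularForm.eta x ^ 4 ≠ 0 := pow_ne_zero 4 (ModularForm.eta_ne_zero x.im_pos)
    rw [hx, ha, Circle.coe_one, one_mul, eq_comm, mul_eq_right₀ h1, sq_eq_one_iff,
      ModularGroup.denom_apply] at heta
    have hd : (γ 1 0 : ℂ) * x + γ 1 1 = ((γ 1 1 : ℤ) : ℂ) ∧ γ 1 0 = 0 ∧
        (γ 1 1 = 1 ∨ γ 1 1 = -1) := by
      have him : ((γ 1 0 : ℂ) * x + γ 1 1).im = γ 1 0 * x.im := by simp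
      have hc : γ 1 0 = 0 := by
        have : (γ 1 0 : ℝ) * x.im = 0 := by
          rw [← him]
          rcases heta with h | h <;> rw [h] <;> simp
        rcases mul_eq_zero.mp this with h | h
        · exact_mod_cast h
        · exact absurd h x.im_pos.ne'
      rw [hc, Int.cast_zero, zero_mul, zero_add] at heta ⊢
      exact ⟨rfl, rfl, by exact_mod_cast heta⟩
    obtain ⟨hd, hc, hd1⟩ := hd
    have hdet := γ.det_coe
    rw [Matrix.det_fin_two, hc, mul_zero, sub_zero] at hdet
    have hxx := congrArg UpperHalfPlane.coe hx
    rw [UpperHalfPlane.coe_specialLinearGroup_apply] at hxx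
    simp only [algebraMap_int_eq, eq_intCast, ofReal_intCast] at hxx
    rw [hd] at hxx
    rcases hd1 with hd1 | hd1
    · rw [hd1, mul_one] at hdet
      rw [hd1, hdet, Int.cast_one, div_one, one_mul, add_eq_left, Int.cast_eq_zero] at hxx
      have : γ = 1 := by
        ext i j
        fin_cases i <;> fin_cases j <;> simp [hdet, hxx, hc, hd1]
      rw [this]
      rfl
    · have ha1 : γ 0 0 = -1 := by rw [hd1] at hdet; linarith
      rw [hd1, ha1] at hxx
      have hb : γ 0 1 = 0 := by
        have : (γ 0 1 : ℂ) = 0 := by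
          push_cast at hxx
          linear_combination -hxx
        exact_mod_cast this
      have : γ = -1 := by
        ext i j
        fin_cases i <;> fin_cases j <;> simp [ha1, hb, hc, hd1]
      rw [this]
      refine (QuotientGroup.eq_one_iff _).mpr (Subgroup.mem_center_iff.mpr fun δ => ?_)
      rw [mul_neg, neg_mul, mul_one, one_mul]

/-! ### Proper discontinuity of the modular group -/

lemma dist_psl_smul (g : PSL(2, ℤ)) (x y : ℍ) : dist (g • x) (g • y) = dist x y := by
  induction g using QuotientGroup.induction_on with
  | H γ =>
    exact dist_smul (Matrix.SpecialLinearGroup.map (Int.castRingHom ℝ) γ : SL(2, ℝ)) x y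

/-- Every point of the upper half plane has a neighbourhood that is preserved by the stabilizer in
the modular group and disjoint from its translates by all other elements. -/
lemma exists_precisely_invariant (x : ℍ) : ∃ U : Set ℍ, IsOpen U ∧ x ∈ U ∧
    (∀ g ∈ stabilizer PSL(2, ℤ) x, ∀ y ∈ U, g • y ∈ U) ∧
    ∀ g ∉ stabilizer PSL(2, ℤ) x, ∀ y ∈ U, g • y ∉ U := by
  obtain ⟨V, hV, hVg⟩ := ProperlyDiscontinuousSMul.exists_nhds_image_smul_eq_self
    (Matrix.SpecialLinearGroup.mapGL ℝ : SL(2, ℤ) →* GL (Fin 2) ℝ).range x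
  obtain ⟨ε, hε, hball⟩ := Metric.mem_nhds_iff.mp hV
  -- A hyperbolic ball about `x` is preserved by the stabilizer, which consists of isometries fixing
  -- the centre.
  refine ⟨Metric.ball x ε, Metric.isOpen_ball, Metric.mem_ball_self hε, fun g hg y hy => ?_,
    fun g hg y hy hgy => hg ?_⟩
  · have h := dist_psl_smul g y x
    rw [mem_stabilizer_iff.mp hg] at h
    rwa [Metric.mem_ball, h]
  · induction g using QuotientGroup.induction_on with
    | H γ => exact hVg ⟨_, γ, rfl⟩ ⟨γ • y, ⟨y, hball hy, rfl⟩, hball hgy⟩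

/-! ### The developing map to the punctured torus -/

/-- The developing map with values in the punctured plane. -/
noncomputable def devPlane (τ : ℍ) : PuncturedPlane := ⟨dev τ, dev_notMem_lattice τ⟩

lemma continuous_devPlane : Continuous devPlane := continuous_dev.subtype_mk _

lemma isOpenMap_devPlane : IsOpenMap devPlane := by
  intro s hs
  have : devPlane '' s = (fun z : PuncturedPlane => z.1) ⁻¹' ((fun τ : ℍ => dev τ) '' s) := by
    ext z
    constructor
    · rintro ⟨τ, hτ, rfl⟩
      exact ⟨τ, hτ, rfl⟩
    · rintro ⟨τ, hτ, h⟩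
      exact ⟨τ, hτ, Subtype.ext h⟩
  rw [this]
  exact (isOpenMap_dev s hs).preimage continuous_subtype_val

lemma surjective_devPlane : Function.Surjective devPlane := fun z => by
  obtain ⟨τ, hτ⟩ := exists_dev_eq z.2
  exact ⟨τ, Subtype.ext hτ⟩

/-- The developing map with values in the punctured torus. -/
noncomputable def devTorus (τ : ℍ) : PuncturedTorus := toTorus (devPlane τ)

/-- In the torus the translational part of a motion disappears and only `rot` remains. -/
lemma isEquivariantCover_devTorus : IsEquivariantCover rot devTorus where
  continuous := continuous_toTorus.comp continuous_devPlane
  isOpenMap := isOpenMap_toTorus.comp isOpenMap_devPlane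
  surjective := surjective_toTorus.comp surjective_devPlane
  map_smul g x := by
    induction g using QuotientGroup.induction_on with
    | H γ =>
      obtain ⟨a, l, h⟩ := exists_develops γ
      refine toTorus_eq_iff.mpr ?_
      change dev (γ • x : ℍ) - (rot (γ : PSL(2, ℤ)) : Circle) * dev x ∈ lattice
      rw [h.rot_eq, h.dev_smul, add_sub_cancel_left]
      exact h.mem_lattice
  exists_smul_eq x y a hxy := by
    obtain ⟨γ, h, hγ⟩ := exists_develops_of_dev_eq a.2 (toTorus_eq_iff.mp hxy)
      (add_sub_cancel _ _).symm
    exact ⟨γ, Subtype.ext h.rot_eq, hγ⟩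

/-! ### The differential of the developing map -/

/-- The derivative of the developing map. -/
noncomputable def devDeriv (τ : ℍ) : ℂ := devFactor * ModularForm.eta τ ^ 4

lemma devDeriv_ne_zero (τ : ℍ) : devDeriv τ ≠ 0 :=
  mul_ne_zero devFactor_ne_zero (pow_ne_zero 4 (ModularForm.eta_ne_zero τ.im_pos))

lemma continuous_devDeriv : Continuous devDeriv := by
  refine continuous_const.mul (Continuous.pow (continuous_iff_continuousAt.mpr fun τ => ?_) 4)
  exact (ModularForm.differentiableAt_eta_of_mem_upperHalfPlaneSet
    τ.im_pos).continuousAt.comp UpperHalfPlane.continuous_coe.continuousAt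

lemma Develops.devDeriv_smul {γ : SL(2, ℤ)} {a : Circle} {l : ℂ} (h : Develops γ a l) (τ : ℍ) :
    devDeriv (γ • τ) = a * UpperHalfPlane.denom γ τ ^ 2 * devDeriv τ := by
  rw [devDeriv, devDeriv, h.eta_smul]
  ring

/-- The unit tangent vectors of the hyperbolic plane correspond to pairs of a point and the
direction of the image of the tangent vector under the developing map. -/
noncomputable def utHomeo : UTH ≃ₜ ℍ × Circle where
  -- The denominator is the norm of the numerator, since a unit tangent vector at `z` has Euclidean
  -- length `Im z`.
  toFun q := (q.1.1, ⟨devDeriv q.1.1 * q.1.2 / (‖devDeriv q.1.1‖ * q.1.1.im : ℝ), by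
    have h1 := norm_pos_iff.mpr (devDeriv_ne_zero q.1.1)
    have h2 := q.1.1.im_pos
    refine mem_sphere_zero_iff_norm.mpr ?_
    rw [norm_div, norm_mul, q.2, norm_real, Real.norm_eq_abs, abs_of_pos (mul_pos h1 h2)]
    exact div_self (mul_pos h1 h2).ne'⟩)
  invFun p := ⟨(p.1, p.2 * (‖devDeriv p.1‖ * p.1.im : ℝ) / devDeriv p.1), by
    have h1 := norm_pos_iff.mpr (devDeriv_ne_zero p.1)
    have h2 := p.1.im_pos
    change ‖(p.2 * (‖devDeriv p.1‖ * p.1.im : ℝ) / devDeriv p.1 : ℂ)‖ = p.1.im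
    rw [norm_div, norm_mul, Circle.norm_coe, norm_real, Real.norm_eq_abs,
      abs_of_pos (mul_pos h1 h2)]
    field_simp⟩
  left_inv q := by
    have h1 := devDeriv_ne_zero q.1.1
    have h2 : ((‖devDeriv q.1.1‖ * q.1.1.im : ℝ) : ℂ) ≠ 0 :=
      ofReal_ne_zero.mpr (mul_pos (norm_pos_iff.mpr h1) q.1.1.im_pos).ne'
    apply Subtype.ext
    apply Prod.ext
    · rfl
    · change devDeriv q.1.1 * q.1.2 / (‖devDeriv q.1.1‖ * q.1.1.im : ℝ) *
        (‖devDeriv q.1.1‖ * q.1.1.im : ℝ) / devDeriv q.1.1 = q.1.2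
      rw [div_mul_cancel₀ _ h2, mul_div_cancel_left₀ _ h1]
  right_inv p := by
    have h1 := devDeriv_ne_zero p.1
    have h2 : ((‖devDeriv p.1‖ * p.1.im : ℝ) : ℂ) ≠ 0 :=
      ofReal_ne_zero.mpr (mul_pos (norm_pos_iff.mpr h1) p.1.im_pos).ne'
    apply Prod.ext
    · rfl
    · apply Circle.coe_injective
      change devDeriv p.1 * (p.2 * (‖devDeriv p.1‖ * p.1.im : ℝ) / devDeriv p.1) /
        (‖devDeriv p.1‖ * p.1.im : ℝ) = p.2
      rw [mul_div_cancel₀ _ h1, mul_div_cancel_right₀ _ h2]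
  continuous_toFun := by
    have h1 : Continuous fun q : UTH => q.1.1 := continuous_fst.comp continuous_subtype_val
    have h2 : Continuous fun q : UTH => q.1.2 := continuous_snd.comp continuous_subtype_val
    have h3 := continuous_devDeriv.comp h1
    refine h1.prodMk (Continuous.subtype_mk ?_ _)
    refine (h3.mul h2).div (continuous_ofReal.comp
      (h3.norm.mul (UpperHalfPlane.continuous_im.comp h1))) fun q => ?_
    exact ofReal_ne_zero.mpr
      (mul_pos (norm_pos_iff.mpr (devDeriv_ne_zero q.1.1)) q.1.1.im_pos).ne'
  continuous_invFun := by
    have h3 : Continuous fun p : ℍ × Circle => devDeriv p.1 :=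
      continuous_devDeriv.comp continuous_fst
    refine Continuous.subtype_mk (continuous_fst.prodMk ?_) _
    exact ((continuous_subtype_val.comp continuous_snd).mul (continuous_ofReal.comp
      (h3.norm.mul (UpperHalfPlane.continuous_im.comp continuous_fst)))).div h3
      fun p => devDeriv_ne_zero p.1

lemma coe_utHomeo_snd (q : UTH) : ((utHomeo q).2 : ℂ) =
    devDeriv q.1.1 * q.1.2 / (‖devDeriv q.1.1‖ * q.1.1.im : ℝ) := rfl

/-- By the chain rule the squared denominators of the derivative of `dev` and of the tangent vector
cancel, and the normalising factor is invariant, so only the rotation `a` remains. -/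
lemma Develops.utHomeo_smul {γ : SL(2, ℤ)} {a : Circle} {l : ℂ} (h : Develops γ a l) (q : UTH) :
    utHomeo (γ • q) = (γ • q.1.1, a * (utHomeo q).2) := by
  apply Prod.ext
  · rfl
  · apply Circle.coe_injective
    rw [Circle.coe_mul, coe_utHomeo_snd, coe_utHomeo_snd]
    change devDeriv (γ • q.1.1) * (q.1.2 / UpperHalfPlane.denom γ q.1.1 ^ 2) /
      (‖devDeriv (γ • q.1.1)‖ * (γ • q.1.1).im : ℝ) = _
    have hd := UpperHalfPlane.denom_ne_zero (γ : GL (Fin 2) ℝ) q.1.1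
    have hn : ‖devDeriv (γ • q.1.1)‖ * (γ • q.1.1).im = ‖devDeriv q.1.1‖ * q.1.1.im := by
      have hd' := norm_pos_iff.mpr hd
      rw [ModularGroup.im_smul_eq_div_normSq, normSq_eq_norm_sq, h.devDeriv_smul, norm_mul,
        norm_mul, norm_pow, Circle.norm_coe]
      field_simp
    rw [hn, h.devDeriv_smul]
    field_simp

/-- The differential of the developing map, with values in the unit tangent bundle of the
punctured torus. -/
noncomputable def devUTTorus (q : UTH) : UTPuncturedTorus :=
  toUTTorus (devPlane (utHomeo q).1) (utHomeo q).2

lemma isEquivariantCover_devUTTorus : IsEquivariantCover rot devUTTorus where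
  continuous := continuous_toUTTorus.comp
    ((continuous_devPlane.prodMap continuous_id).comp utHomeo.continuous)
  isOpenMap := isOpenMap_toUTTorus.comp
    ((isOpenMap_devPlane.prodMap IsOpenMap.id).comp utHomeo.isOpenMap)
  surjective := surjective_toUTTorus.comp
    ((surjective_devPlane.prodMap Function.surjective_id).comp utHomeo.surjective)
  map_smul g q := by
    induction g using QuotientGroup.induction_on with
    | H γ =>
      obtain ⟨a, l, h⟩ := exists_develops γ
      change toUTTorus (devPlane (utHomeo (γ • q)).1) (utHomeo (γ • q)).2 = _
      rw [devUTTorus, smul_toUTTorus, h.utHomeo_smul, h.rot_eq]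
      refine toUTTorus_eq_iff.mpr ⟨?_, rfl⟩
      change dev (γ • q.1.1 : ℍ) - (rot (γ : PSL(2, ℤ)) : Circle) * dev q.1.1 ∈ lattice
      rw [h.rot_eq, h.dev_smul, add_sub_cancel_left]
      exact h.mem_lattice
  exists_smul_eq q r a hqr := by
    rw [devUTTorus, devUTTorus, smul_toUTTorus, toUTTorus_eq_iff] at hqr
    obtain ⟨γ, h, hγ⟩ := exists_develops_of_dev_eq (τ₁ := (utHomeo q).1) (τ₂ := (utHomeo r).1)
      a.2 hqr.1 (add_sub_cancel _ _).symm
    refine ⟨γ, Subtype.ext h.rot_eq, utHomeo.injective ?_⟩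
    change utHomeo (γ • q) = _
    rw [h.utHomeo_smul]
    exact Prod.ext hγ hqr.2.symm

/-! ### The rotations that generate the covering transformations -/

/-- The rotations by the same angle about `c` and about `0` differ by the translation by `c - a c`,
which is invisible in the torus when it lies in the lattice. -/
lemma isRotation_smulHom {a : sixth} {c : ℂ} {θ : ℝ} (ha : (a : Circle) = Circle.exp θ)
    (hc : c - (a : Circle) * c ∈ lattice) : IsRotation (smulHom sixth PuncturedTorus a) c θ := by
  intro z
  refine ⟨(⟨_, hc⟩ : lattice) +ᵥ a • z, ?_, ?_⟩
  · rw [coe_vadd_puncturedPlane, coe_smul_puncturedPlane, rotate, ← ha]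
    ring
  · rw [smulHom_apply, smul_toTorus]
    refine toTorus_eq_iff.mpr ?_
    rw [coe_vadd_puncturedPlane, sub_add_cancel_right]
    exact neg_mem hc

lemma isGlideRotation_smulHom {a : sixth} {c : ℂ} {θ : ℝ} (ha : (a : Circle) = Circle.exp θ)
    (hc : c - (a : Circle) * c ∈ lattice) :
    IsGlideRotation (smulHom sixth UTPuncturedTorus a) c θ := by
  intro z v
  refine ⟨(⟨_, hc⟩ : lattice) +ᵥ a • z, ?_, ?_⟩
  · rw [coe_vadd_puncturedPlane, coe_smul_puncturedPlane, rotate, ← ha]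
    ring
  · rw [smulHom_apply, smul_toUTTorus, ← ha]
    refine toUTTorus_eq_iff.mpr ⟨?_, rfl⟩
    rw [coe_vadd_puncturedPlane, sub_add_cancel_right]
    exact neg_mem hc

lemma orderOf_zetaGen : orderOf zetaGen = 6 := by
  rw [← Subgroup.orderOf_coe]
  exact orderOf_zeta

lemma coe_zetaGen_sq : ((zetaGen ^ 2 : sixth) : Circle) = Circle.exp (2 * Real.pi / 3) := by
  change zeta ^ 2 = _
  rw [zeta, ← Circle.exp_nsmul]
  congr 1
  simp only [nsmul_eq_mul]
  push_cast
  ring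

lemma coe_zetaGen_cube : ((zetaGen ^ 3 : sixth) : Circle) = Circle.exp Real.pi :=
  zeta_cube_eq_exp_pi

lemma triangleCentre_sub_mem_lattice :
    triangleCentre - ((zetaGen ^ 2 : sixth) : Circle) * triangleCentre ∈ lattice := by
  have : triangleCentre - ((zetaGen ^ 2 : sixth) : Circle) * triangleCentre = 1 := by
    change triangleCentre - ((zeta ^ 2 : Circle) : ℂ) * triangleCentre = 1
    rw [triangleCentre, ← coe_zeta, Circle.coe_pow]
    linear_combination (-(2 : ℂ) / 3 - zeta / 3) * zeta_sq
  rw [this]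
  exact one_mem_lattice

lemma edgeCentre_sub_mem_lattice :
    edgeCentre - ((zetaGen ^ 3 : sixth) : Circle) * edgeCentre ∈ lattice := by
  have : edgeCentre - ((zetaGen ^ 3 : sixth) : Circle) * edgeCentre = 1 := by
    change edgeCentre - ((zeta ^ 3 : Circle) : ℂ) * edgeCentre = 1
    rw [edgeCentre, Circle.coe_pow, zeta_cube]
    norm_num
  rw [this]
  exact one_mem_lattice

lemma closure_zetaGen_sq_cube : Subgroup.closure {zetaGen ^ 2, zetaGen ^ 3} = ⊤ := by
  refine (Subgroup.eq_top_iff' _).mpr fun a => ?_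
  have h2 : zetaGen ^ 2 ∈ Subgroup.closure {zetaGen ^ 2, zetaGen ^ 3} :=
    Subgroup.subset_closure (Set.mem_insert _ _)
  have h3 : zetaGen ^ 3 ∈ Subgroup.closure {zetaGen ^ 2, zetaGen ^ 3} :=
    Subgroup.subset_closure (Set.mem_insert_of_mem _ rfl)
  have h1 : zetaGen ∈ Subgroup.closure {zetaGen ^ 2, zetaGen ^ 3} := by
    have := mul_mem h3 (inv_mem h2)
    have h : zetaGen ^ 3 * (zetaGen ^ 2)⁻¹ = zetaGen := by group
    rwa [h] at this
  obtain ⟨k, -, hk⟩ := exists_pow_of_mem_sixth a.2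
  have : a = zetaGen ^ k := Subtype.ext hk
  rw [this]
  exact pow_mem h1 k

lemma range_smulHom {M : Type*} [TopologicalSpace M] [MulAction sixth M]
    [ContinuousConstSMul sixth M] : (smulHom sixth M).range =
      Subgroup.closure {smulHom sixth M (zetaGen ^ 2), smulHom sixth M (zetaGen ^ 3)} := by
  rw [MonoidHom.range_eq_map, ← closure_zetaGen_sq_cube, MonoidHom.map_closure, Set.image_pair]

lemma orderOf_smulHom {M : Type*} [TopologicalSpace M] [MulAction sixth M]
    [ContinuousConstSMul sixth M] (h : Function.Injective (smulHom sixth M)) :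
    orderOf (smulHom sixth M (zetaGen ^ 2)) = 3 ∧
      orderOf (smulHom sixth M (zetaGen ^ 3)) = 2 := by
  rw [orderOf_injective _ h, orderOf_injective _ h, orderOf_pow, orderOf_pow, orderOf_zetaGen]
  exact ⟨rfl, rfl⟩

/-- Both sides are the class of the base point of a tangent vector above `t`, since `utHomeo` keeps
base points. -/
lemma projMod_descend (t : UTPuncturedTorus) :
    projMod (isEquivariantCover_devUTTorus.descend t) =
      isEquivariantCover_devTorus.descend (projTorus t) := by
  obtain ⟨q, rfl⟩ := isEquivariantCover_devUTTorus.surjective t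
  rw [isEquivariantCover_devUTTorus.descend_apply]
  exact (isEquivariantCover_devTorus.descend_apply q.1.1).symm

end SixFold

/-! ### The two coverings and their deck groups. -/

open SixFold

theorem lemma2p1 :
    ∃ (p : SixFold.PuncturedTorus → SixFold.ModularSurface)
      (P : SixFold.UTPuncturedTorus → SixFold.UTModularSurface)
      (V U : SixFold.PuncturedTorus ≃ₜ SixFold.PuncturedTorus)
      (V' U' : SixFold.UTPuncturedTorus ≃ₜ SixFold.UTPuncturedTorus),
      -- the punctured torus is a 6-fold cover of the modular surface
      SixFold.IsOrbifoldCoverOfDegree 6 p ∧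
      -- whose covering transformations are generated by rotations of orders three and two
      SixFold.IsRotation V SixFold.triangleCentre (2 * Real.pi / 3) ∧ orderOf V = 3 ∧
      SixFold.IsRotation U SixFold.edgeCentre Real.pi ∧ orderOf U = 2 ∧
      SixFold.deckGroup p = Subgroup.closure {V, U} ∧
      -- the unit tangent bundle is a 6-fold cover of that of the modular surface
      SixFold.IsCoverOfDegree 6 P ∧
      -- whose covering transformations are generated by glide rotations of orders three and two
      SixFold.IsGlideRotation V' SixFold.triangleCentre (2 * Real.pi / 3) ∧ orderOf V' = 3 ∧
      SixFold.IsGlideRotation U' SixFold.edgeCentre Real.pi ∧ orderOf U' = 2 ∧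
      SixFold.deckGroup P = Subgroup.closure {V', U'} ∧
      -- and the second covering lies over the first
      ∀ q : SixFold.UTPuncturedTorus,
        SixFold.projMod (P q) = p (SixFold.projTorus q) := by
  have hfree (t : UTPuncturedTorus) (a : sixth) (h : a • t = t) : a = 1 :=
    isCancelSMul_iff_eq_one_of_smul_eq.mp inferInstance a t h
  -- One point with trivial stabilizer makes the action faithful, so the orders of `zeta ^ 2` and
  -- `zeta ^ 3` carry over to the homeomorphisms.
  obtain ⟨t, ht⟩ := isConnected_freeTorus.nonempty
  obtain ⟨hV, hU⟩ := orderOf_smulHom (smulHom_injective fun a => eq_one_of_mem_freeTorus ht)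
  obtain ⟨t', -⟩ := isConnected_univ_utPuncturedTorus.nonempty
  obtain ⟨hV', hU'⟩ := orderOf_smulHom (smulHom_injective (hfree t'))
  refine ⟨isEquivariantCover_devTorus.descend, isEquivariantCover_devUTTorus.descend,
    smulHom sixth _ (zetaGen ^ 2), smulHom sixth _ (zetaGen ^ 3),
    smulHom sixth _ (zetaGen ^ 2), smulHom sixth _ (zetaGen ^ 3),
    ⟨isEquivariantCover_devTorus.isOrbifoldCover_descend eq_one_of_rot_eq_one
      exists_precisely_invariant, fun x => ?_⟩,
    isRotation_smulHom coe_zetaGen_sq triangleCentre_sub_mem_lattice, hV,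
    isRotation_smulHom coe_zetaGen_cube edgeCentre_sub_mem_lattice, hU, ?_, ?_,
    isGlideRotation_smulHom coe_zetaGen_sq triangleCentre_sub_mem_lattice, hV',
    isGlideRotation_smulHom coe_zetaGen_cube edgeCentre_sub_mem_lattice, hU', ?_,
    projMod_descend⟩
  · rw [isEquivariantCover_devTorus.card_fiber_mul_card_stabilizer eq_one_of_rot_eq_one, card_sixth]
  · rw [← range_smulHom]
    exact isEquivariantCover_devTorus.deckGroup_descend isConnected_freeTorus dense_freeTorus
      fun t ht a => eq_one_of_mem_freeTorus ht
  · rw [← card_sixth]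
    exact isEquivariantCover_devUTTorus.isCoverOfDegree_descend
  · rw [← range_smulHom]
    exact isEquivariantCover_devUTTorus.deckGroup_descend isConnected_univ_utPuncturedTorus
      dense_univ fun t _ => hfree t
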